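/- Let $B_n$ be the group of permutations $w$ of $\{\pm1,\dots,\pm n\}$ with $w(-i)=-w(i)$ for all $i$. For elements $a_1,\dots,a_k$ with distinct absolute values write $[a_1,\dots,a_k]$ for the balanced cycle $(a_1\,\cdots\,a_k\,{-a_1}\,\cdots\,{-a_k})$ (the identity $e$ if $k=0$) and $((a_1,\dots,a_k))$ for the paired cycle $(a_1\,\cdots\,a_k)(-a_1\,\cdots\,{-a_k})$. Let $\ell(w)$ be the smallest number of factors in an expression of $w$ as a product of reflections $[i]$ $(1\le i\le n)$, $((i,j))$, $((i,-j))$ $(1\le i<j\le n)$, and let $\mathrm{Abs}(B_n)$ be $B_n$ with the absolute order: $u\preceq v$ if and only if $\ell(u)+\ell(u^{-1}v)=\ell(v)$. For integers $k,r\ge 0$ with $k+r=n$ let $L(k,r)$ be the interval $[e,\,[1,2,\dots,k][k+1][k+2]\cdots[k+r]]$ of $\mathrm{Abs}(B_n)$, and let $\mathcal L_r=L(0,r)$. For a finite bounded poset $P$ let $\#P$ be its cardinality, $Z(P,m)$ its zeta polynomial (the polynomial in $m$ whose value at each integer $m\ge2$ is the number of multichains $x_1\le x_2\le\cdots\le x_{m-1}$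 in $P$), and $\mu(P)=\mu_P(\hat0,\hat1)$ its Möbius number. Put $\alpha_r=\#\mathcal L_r$, $\beta_r(m)=Z(\mathcal L_r,m)$, $\mu_r=\mu(\mathcal L_r)$. **Proposition 7.1.** For all integers $k,r\ge0$ with $n=k+r$, $$\#L(k,r)=\binom{2k}{k}\left(\frac{2rk}{k+1}\,\alpha_{r-1}+\alpha_r\right),$$ $$Z(L(k,r),m)=\binom{mk}{k}\left(\frac{2rk}{k+1}\,(m-1)\,\beta_{r-1}(m)+\beta_r(m)\right),$$ $$\mu(L(k,r))=(-1)^n\binom{2k-1}{k}\left(\frac{4rk}{k+1}\,|\mu_{r-1}|+|\mu_r|\right),$$ where the second formula is an identity of polynomials in $m$, with $\binom{x}{k}=x(x-1)\cdots(x-k+1)/k!$; in particular $\binom{-1}{0}=1$. For $r=0$ the terms with index $r-1$, which carry the factor $r$, are read as $0$. -/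

import Mathlib

open Equiv

/-! ### Absolute length and absolute order of a group with respect to a generating set -/

/-- The absolute length of `g` with respect to `T`: the smallest `m` such that `g` is a product of
`m` elements of `T`. -/
noncomputable def absLength {G : Type*} [Group G] (T : Set G) (g : G) : ℕ :=
  sInf {m | ∃ l : List G, (∀ t ∈ l, t ∈ T) ∧ l.prod = g ∧ l.length = m}

section AbsLength

variable {G : Type*} [Group G] {T : Set G}

theorem absLength_le {l : List G} (h : ∀ t ∈ l, t ∈ T) : absLength T l.prod ≤ l.length :=
  Nat.sInf_le ⟨l, h, rfl, rfl⟩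

theorem absLength_one : absLength T (1 : G) = 0 :=
  Nat.le_zero.1 (absLength_le (T := T) (l := []) (by simp))

theorem exists_list_absLength {g : G} (h : ∃ l : List G, (∀ t ∈ l, t ∈ T) ∧ l.prod = g) :
    ∃ l : List G, (∀ t ∈ l, t ∈ T) ∧ l.prod = g ∧ l.length = absLength T g := by
  obtain ⟨l, h1, h2⟩ := h
  exact Nat.sInf_mem (s := {m | ∃ l : List G, (∀ t ∈ l, t ∈ T) ∧ l.prod = g ∧ l.length = m})
    ⟨l.length, l, h1, h2, rfl⟩

theorem eq_one_of_absLength_eq_zero (hT : ∀ g : G, ∃ l : List G, (∀ t ∈ l, t ∈ T) ∧ l.prod = g)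
    {g : G} (hg : absLength T g = 0) : g = 1 := by
  obtain ⟨l, -, h2, h3⟩ := exists_list_absLength (hT g)
  rw [hg, List.length_eq_zero_iff] at h3
  subst h3
  simpa using h2.symm

theorem absLength_mul_le (hT : ∀ g : G, ∃ l : List G, (∀ t ∈ l, t ∈ T) ∧ l.prod = g) (g h : G) :
    absLength T (g * h) ≤ absLength T g + absLength T h := by
  obtain ⟨l, h1, h2, h3⟩ := exists_list_absLength (hT g)
  obtain ⟨l', h1', h2', h3'⟩ := exists_list_absLength (hT h)
  have := absLength_le (T := T) (l := l ++ l') (by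
    intro t ht
    rcases List.mem_append.1 ht with ht | ht
    · exact h1 t ht
    · exact h1' t ht)
  rw [List.prod_append, h2, h2', List.length_append, h3, h3'] at this
  exact this

/-- The absolute order: `u ≼ v` iff `ℓ(u) + ℓ(u⁻¹ v) = ℓ(v)`. -/
@[reducible] noncomputable def absOrder (T : Set G)
    (hT : ∀ g : G, ∃ l : List G, (∀ t ∈ l, t ∈ T) ∧ l.prod = g) : PartialOrder G where
  le u v := absLength T u + absLength T (u⁻¹ * v) = absLength T v
  le_refl u := by simp [absLength_one]
  le_trans u v w huv hvw := by
    have h1 := absLength_mul_le hT u (u⁻¹ * w)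
    have h2 := absLength_mul_le hT (u⁻¹ * v) (v⁻¹ * w)
    have e1 : u * (u⁻¹ * w) = w := by group
    have e2 : (u⁻¹ * v) * (v⁻¹ * w) = u⁻¹ * w := by group
    rw [e1] at h1
    rw [e2] at h2
    omega
  le_antisymm u v huv hvu := by
    have h : absLength T (u⁻¹ * v) = 0 := by omega
    have := eq_one_of_absLength_eq_zero hT h
    exact (inv_mul_eq_one.1 this)

end AbsLength

/-! ### The hyperoctahedral group -/

/-- The set `{±1, …, ±n}`: the pair `(i, s)` stands for `s * (i + 1)`. -/
def SignedPt (n : ℕ) : Type := Fin n × ℤˣ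

namespace SignedPt

variable {n : ℕ}

instance : DecidableEq (SignedPt n) := inferInstanceAs (DecidableEq (Fin n × ℤˣ))

instance : Fintype (SignedPt n) := inferInstanceAs (Fintype (Fin n × ℤˣ))

/-- Change of sign. -/
instance : InvolutiveNeg (SignedPt n) where
  neg x := (x.1, -x.2)
  neg_neg x := Prod.ext rfl (neg_neg x.2)

/-- The positive element `i + 1`. -/
def pos (i : Fin n) : SignedPt n := (i, 1)

theorem ne_neg (x : SignedPt n) : x ≠ -x := fun h =>
  units_ne_neg_self x.2 (congrArg Prod.snd h)

theorem pos_injective : Function.Injective (pos (n := n)) := fun _ _ h => congrArg Prod.fst h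

theorem pos_ne_neg_pos (i j : Fin n) : pos i ≠ -pos j := fun h =>
  units_ne_neg_self (1 : ℤˣ) (congrArg Prod.snd h)

theorem eq_pos_or (x : SignedPt n) : x = pos x.1 ∨ x = -pos x.1 := by
  rcases Int.units_eq_one_or x.2 with h | h
  · exact Or.inl (Prod.ext rfl h)
  · exact Or.inr (Prod.ext rfl h)

end SignedPt

open SignedPt

/-- The hyperoctahedral group `B_n`, as a subgroup of the group of all permutations of
`{±1, …, ±n}`: the permutations `w` with `w(-x) = -w(x)`. -/
def signedPerms (n : ℕ) : Subgroup (Perm (SignedPt n)) where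
  carrier := {w | ∀ x, w (-x) = -w x}
  one_mem' _ := rfl
  mul_mem' {a b} ha hb x := by
    have h1 : b (-x) = -b x := hb x
    have h2 : a (-b x) = -a (b x) := ha (b x)
    simp [h1, h2]
  inv_mem' {a} ha x := by
    have h : a (-(a⁻¹ x)) = -a (a⁻¹ x) := ha _
    exact a.injective (by rw [h]; simp)

/-- The group `B_n`, as a type to be equipped with the absolute order. -/
def AbsB (n : ℕ) : Type := signedPerms n

namespace AbsB

variable {n : ℕ}

instance : Group (AbsB n) := inferInstanceAs (Group (signedPerms n))

instance : Finite (AbsB n) := inferInstanceAs (Finite (signedPerms n))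

/-- The underlying permutation of `{±1, …, ±n}`. -/
def toPerm (w : AbsB n) : Perm (SignedPt n) := Subtype.val w

end AbsB

/-- The paired cycle `((a₁, …, a_k)) = (a₁ … a_k)(-a₁ … -a_k)`. -/
def pairedCycle {n : ℕ} (l : List (SignedPt n)) : Perm (SignedPt n) :=
  l.formPerm * (l.map Neg.neg).formPerm

/-- The balanced cycle `[a₁, …, a_k] = (a₁ … a_k -a₁ … -a_k)`; it is the identity for `k = 0`. -/
def balancedCycle {n : ℕ} (l : List (SignedPt n)) : Perm (SignedPt n) :=
  (l ++ l.map Neg.neg).formPerm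

/-- The reflections of `B_n`: all `[i]`, and all `((i, j))` and `((i, -j))` with `i < j`. -/
def reflections (n : ℕ) : Set (AbsB n) :=
  {t | (∃ i, t.toPerm = balancedCycle [pos i]) ∨
    ∃ i j, i < j ∧
      (t.toPerm = pairedCycle [pos i, pos j] ∨ t.toPerm = pairedCycle [pos i, -pos j])}

section Generation

variable {n : ℕ}

theorem formPerm_map_neg (l : List (SignedPt n)) (x : SignedPt n) :
    (l.map Neg.neg).formPerm (-x) = -(l.formPerm x) := by
  induction l generalizing x with
  | nil => rfl
  | cons a l ih =>
    cases l with
    | nil => rfl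
    | cons b l =>
      rw [List.map_cons, List.map_cons, List.formPerm_cons_cons, List.formPerm_cons_cons,
        Perm.mul_apply, Perm.mul_apply]
      have := ih x
      rw [List.map_cons] at this
      rw [this]
      simp only [swap_apply_def, neg_inj]
      split_ifs <;> rfl

theorem balancedCycle_mem {l : List (SignedPt n)} (h : (l ++ l.map Neg.neg).Nodup) :
    balancedCycle l ∈ signedPerms n := by
  intro x
  have h1 := formPerm_map_neg (l ++ l.map Neg.neg) x
  have h2 : (l ++ l.map Neg.neg).map Neg.neg = (l ++ l.map Neg.neg).rotate l.length := by
    rw [List.rotate_append_length_eq, List.map_append, List.map_map]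
    simp
  rw [h2, List.formPerm_rotate _ h] at h1
  exact h1

theorem balancedCycle_pos_mem {l : List (Fin n)} (h : l.Nodup) :
    balancedCycle (l.map pos) ∈ signedPerms n := by
  apply balancedCycle_mem
  rw [List.nodup_append]
  refine ⟨h.map pos_injective, (h.map pos_injective).map neg_injective, ?_⟩
  intro a ha b hb
  simp only [List.mem_map] at ha hb
  obtain ⟨i, -, rfl⟩ := ha
  obtain ⟨_, ⟨j, -, rfl⟩, rfl⟩ := hb
  exact pos_ne_neg_pos i j

/-- The reflection exchanging `a` with `b` and `-a` with `-b`. -/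
theorem exists_reflection (a b : SignedPt n) (hab : a ≠ b) :
    ∃ t ∈ reflections n, t.toPerm b = a ∧
      ∀ x, x ≠ a → x ≠ b → x ≠ -a → x ≠ -b → t.toPerm x = x := by
  by_cases hn : b = -a
  · subst hn
    have key : ∀ i : Fin n, balancedCycle [pos i] ∈ signedPerms n := fun i => by
      simpa using balancedCycle_pos_mem (l := [i]) (by simp)
    refine ⟨⟨balancedCycle [pos a.1], key _⟩, Or.inl ⟨a.1, rfl⟩, ?_⟩
    have e : balancedCycle [pos a.1] = swap (pos a.1) (-pos a.1) := by
      simp [balancedCycle]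
    simp only [AbsB.toPerm, e]
    rcases a.eq_pos_or with h | h
    · rw [← h]
      refine ⟨swap_apply_right _ _, fun x h1 h2 _ _ => swap_apply_of_ne_of_ne h1 h2⟩
    · have h' : pos a.1 = -a := by conv_rhs => rw [h, neg_neg]
      rw [h', neg_neg]
      refine ⟨swap_apply_left _ _, fun x h1 h2 _ _ => swap_apply_of_ne_of_ne h2 h1⟩
  · have hmem : ∀ c d : SignedPt n, pairedCycle [c, d] = swap c d * swap (-c) (-d) := by
      intro c d; simp [pairedCycle]
    have hcomm : ∀ c d : SignedPt n, c ≠ d → d ≠ -c →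
        swap c d * swap (-c) (-d) = swap (-c) (-d) * swap c d := by
      intro c d h1 h2
      have e1 : -c ≠ d := fun h => h2 h.symm
      have e2 : -d ≠ c := fun h => h2 (by rw [← h, neg_neg])
      refine Perm.Disjoint.commute (f := swap c d) (g := swap (-c) (-d)) fun x => ?_
      by_cases hx : x = c
      · subst hx
        exact Or.inr (swap_apply_of_ne_of_ne (ne_neg _) e2.symm)
      by_cases hx' : x = d
      · subst hx'
        exact Or.inr (swap_apply_of_ne_of_ne h2 (ne_neg _))
      exact Or.inl (swap_apply_of_ne_of_ne hx hx')
    have hmem' : ∀ c d : SignedPt n, c ≠ d → d ≠ -c →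
        swap c d * swap (-c) (-d) ∈ signedPerms n := by
      intro c d h1 h2 x
      have := congrArg (fun f : Perm (SignedPt n) => f (-x)) (hcomm c d h1 h2)
      have e : ∀ (c d y : SignedPt n), swap (-c) (-d) (-y) = -swap c d y := by
        intro c d y
        simp only [swap_apply_def, neg_inj]
        split_ifs <;> rfl
      have e' : ∀ (c d y : SignedPt n), swap c d (-y) = -swap (-c) (-d) y := by
        intro c d y
        simpa using e (-c) (-d) y
      rw [Perm.mul_apply, e, e', ← Perm.mul_apply, ← hcomm c d h1 h2]
    have hact : ∀ c d : SignedPt n, c ≠ d → d ≠ -c →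
        (swap c d * swap (-c) (-d)) d = c ∧ (swap c d * swap (-c) (-d)) c = d ∧
        ∀ x, x ≠ c → x ≠ d → x ≠ -c → x ≠ -d → (swap c d * swap (-c) (-d)) x = x := by
      intro c d h1 h2
      have e2 : c ≠ -d := fun h => h2 (by rw [h, neg_neg])
      refine ⟨?_, ?_, ?_⟩
      · rw [Perm.mul_apply, swap_apply_of_ne_of_ne h2 (ne_neg _), swap_apply_right]
      · rw [Perm.mul_apply, swap_apply_of_ne_of_ne (ne_neg _) e2, swap_apply_left]
      · intro x h1 h2 h3 h4
        rw [Perm.mul_apply, swap_apply_of_ne_of_ne h3 h4, swap_apply_of_ne_of_ne h1 h2]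
    have hsymm : ∀ c d : SignedPt n, swap c d * swap (-c) (-d) = swap d c * swap (-d) (-c) := by
      intro c d; rw [swap_comm c d, swap_comm (-c) (-d)]
    have hneg : ∀ c d : SignedPt n, c ≠ d → d ≠ -c →
        swap c d * swap (-c) (-d) = swap (-c) (-d) * swap (- -c) (- -d) := by
      intro c d h1 h2
      rw [neg_neg, neg_neg, hcomm c d h1 h2]
    refine ⟨⟨swap a b * swap (-a) (-b), hmem' a b hab hn⟩, Or.inr ?_, (hact a b hab hn).1,
      (hact a b hab hn).2.2⟩
    have hidx : a.1 ≠ b.1 := by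
      intro h
      rcases a.eq_pos_or with ha | ha <;> rcases b.eq_pos_or with hb | hb
      · exact hab (by rw [ha, hb, h])
      · exact hn (by rw [ha, hb, h])
      · exact hn (by rw [ha, hb, h, neg_neg])
      · exact hab (by rw [ha, hb, h])
    have main : ∀ c d : SignedPt n, c.1 < d.1 → c ≠ d → d ≠ -c → ∃ i j : Fin n, i < j ∧
        (swap c d * swap (-c) (-d) = pairedCycle [pos i, pos j] ∨
          swap c d * swap (-c) (-d) = pairedCycle [pos i, -pos j]) := by
      intro c d hlt h1 h2
      refine ⟨c.1, d.1, hlt, ?_⟩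
      simp only [hmem]
      rcases c.eq_pos_or with hc | hc <;> rcases d.eq_pos_or with hd | hd
      · left; rw [← hc, ← hd]
      · right; rw [← hc, ← hd]
      · right
        have hc' : pos c.1 = -c := by conv_rhs => rw [hc, neg_neg]
        rw [hc', ← hd]; exact hneg c d h1 h2
      · left
        have hc' : pos c.1 = -c := by conv_rhs => rw [hc, neg_neg]
        have hd' : pos d.1 = -d := by conv_rhs => rw [hd, neg_neg]
        rw [hc', hd']; exact hneg c d h1 h2
    rcases lt_or_gt_of_ne hidx with h | h
    · exact main a b h hab hn
    · have := main b a h hab.symm (fun h => hn (by rw [h, neg_neg]))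
      simpa only [AbsB.toPerm, hsymm a b] using this

/-- `B_n` is generated by its reflections. -/
theorem exists_list_reflections (w : AbsB n) :
    ∃ l : List (AbsB n), (∀ t ∈ l, t ∈ reflections n) ∧ l.prod = w := by
  induction h : w.toPerm.support.card using Nat.strong_induction_on generalizing w with
  | _ m ih =>
    by_cases hw : w.toPerm = 1
    · exact ⟨[], by simp, (Subtype.ext hw : w = 1).symm⟩
    obtain ⟨x, hx⟩ : ∃ x, w.toPerm x ≠ x := by
      by_contra! hc
      exact hw (Perm.ext hc)
    have hwneg : ∀ y, w.toPerm (-y) = -w.toPerm y := w.2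
    obtain ⟨t, ht, h1, h2⟩ := exists_reflection x (w.toPerm x) hx.symm
    have hmul : ∀ y, (t * w).toPerm y = t.toPerm (w.toPerm y) := fun _ => rfl
    have hlt : (t * w).toPerm.support.card < m := by
      rw [← h]
      apply Finset.card_lt_card
      refine Finset.ssubset_iff_of_subset ?_ |>.2 ⟨x, Perm.mem_support.2 hx, ?_⟩
      · intro y hy
        rw [Perm.mem_support] at hy ⊢
        intro hwy
        apply hy
        rw [hmul, hwy]
        have hwx : ∀ z, w.toPerm z = z → z ≠ x := by
          rintro z hz rfl; exact hx hz
        have hwy' : w.toPerm (-y) = -y := by rw [hwneg, hwy]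
        refine h2 y (hwx y hwy) ?_ ?_ ?_
        · intro he
          rw [← hwy] at he
          exact hwx y hwy (w.toPerm.injective he)
        · intro he
          exact hwx (-y) hwy' (by rw [he, neg_neg])
        · intro he
          have : -y = w.toPerm x := by rw [he, neg_neg]
          rw [← hwy'] at this
          exact hwx _ hwy' (w.toPerm.injective this)
      · rw [Perm.mem_support, hmul, h1]
        exact fun h => h rfl
    obtain ⟨l, hl1, hl2⟩ := ih _ hlt (t * w) rfl
    obtain ⟨t', ht', ht1⟩ : ∃ t' ∈ reflections n, t' * t = 1 := by
      refine ⟨t, ht, Subtype.ext ?_⟩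
      show t.toPerm * t.toPerm = 1
      have hp : ∀ c d : SignedPt n, c ≠ d → d ≠ -c → pairedCycle [c, d] * pairedCycle [c, d] = 1 := by
        intro c d e1 e2
        have e3 : c ≠ -d := fun h => e2 (by rw [h, neg_neg])
        have hc : Commute (swap c d) (swap (-c) (-d)) := by
          refine Perm.Disjoint.commute fun x => ?_
          by_cases hx : x = c
          · subst hx
            exact Or.inr (swap_apply_of_ne_of_ne (ne_neg _) e3)
          by_cases hx' : x = d
          · subst hx'
            exact Or.inr (swap_apply_of_ne_of_ne e2 (ne_neg _))
          exact Or.inl (swap_apply_of_ne_of_ne hx hx')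
        have he : pairedCycle [c, d] = swap c d * swap (-c) (-d) := by simp [pairedCycle]
        rw [he, hc.symm.mul_mul_mul_comm, swap_mul_self, swap_mul_self, one_mul]
      rcases ht with ⟨i, hi⟩ | ⟨i, j, hij, hi | hi⟩
      · rw [hi]; simp [balancedCycle]
      · rw [hi]
        exact hp _ _ (fun h => hij.ne (pos_injective h)) (pos_ne_neg_pos _ _)
      · rw [hi]
        refine hp _ _ (pos_ne_neg_pos _ _) (fun h => hij.ne ?_)
        exact (pos_injective (neg_injective h)).symm
    refine ⟨t' :: l, ?_, ?_⟩
    · intro s hs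
      rcases List.mem_cons.1 hs with rfl | hs
      · exact ht'
      · exact hl1 s hs
    · rw [List.prod_cons, hl2, ← mul_assoc, ht1, one_mul]

end Generation

/-- The absolute order `Abs(B_n)`. -/
noncomputable instance AbsB.instPartialOrder (n : ℕ) : PartialOrder (AbsB n) :=
  absOrder (reflections n) exists_list_reflections

theorem AbsB.le_iff {n : ℕ} (u v : AbsB n) : u ≤ v ↔
    absLength (reflections n) u + absLength (reflections n) (u⁻¹ * v) =
      absLength (reflections n) v := Iff.rfl

instance AbsB.instFactOneLe {n : ℕ} (w : AbsB n) : Fact (1 ≤ w) :=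
  ⟨by rw [AbsB.le_iff, absLength_one, inv_one, one_mul, zero_add]⟩

/-! ### The intervals `L(k, r)` -/

/-- The element `[1, 2, …, k][k+1][k+2]⋯[k+r]` of `B_{k+r}`. -/
def hookElement (k r : ℕ) : AbsB (k + r) :=
  ⟨balancedCycle (((List.finRange k).map (Fin.castAdd r)).map pos) *
      ((List.finRange r).map fun j => balancedCycle [pos (Fin.natAdd k j)]).prod, by
    refine mul_mem (balancedCycle_pos_mem
      ((List.nodup_finRange k).map (Fin.castAdd_injective k r))) (Subgroup.list_prod_mem _ ?_)
    intro x hx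
    obtain ⟨j, -, rfl⟩ := List.mem_map.1 hx
    simpa using balancedCycle_pos_mem (l := [Fin.natAdd k j]) (by simp)⟩

/-- The interval `L(k, r) = [e, [1, …, k][k+1]⋯[k+r]]` of `Abs(B_{k+r})`, with the induced order. -/
abbrev IntervalL (k r : ℕ) : Type := Set.Icc (1 : AbsB (k + r)) (hookElement k r)

/-- The poset `𝓛_r = L(0, r)`. -/
abbrev PosetL (r : ℕ) : Type := IntervalL 0 r

/-! ### Zeta polynomial and Möbius number of a finite poset -/

section Zeta

/-- The number of multichains `x_1 ≤ x_2 ≤ ⋯ ≤ x_j` of `P`. -/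
noncomputable def multichainCount (P : Type*) [PartialOrder P] (j : ℕ) : ℕ := Nat.card (Fin j →o P)

theorem exists_polynomial_sum_range (p : Polynomial ℚ) :
    ∃ q : Polynomial ℚ, ∀ n : ℕ, q.eval (n : ℚ) = ∑ i ∈ Finset.range n, p.eval (i : ℚ) := by
  induction p using Polynomial.induction_on' with
  | add p q hp hq =>
    obtain ⟨a, ha⟩ := hp
    obtain ⟨b, hb⟩ := hq
    exact ⟨a + b, fun n => by simp [ha, hb, Finset.sum_add_distrib]⟩
  | monomial d c =>
    refine ⟨Polynomial.C c * ∑ i ∈ Finset.range (d + 1),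
      Polynomial.C (bernoulli i * ((d + 1).choose i) / (d + 1)) * Polynomial.X ^ (d + 1 - i),
      fun n => ?_⟩
    simp only [Polynomial.eval_monomial, ← Finset.mul_sum]
    rw [sum_range_pow, Polynomial.eval_mul, Polynomial.eval_C, Polynomial.eval_finsetSum]
    congr 1
    refine Finset.sum_congr rfl fun i _ => ?_
    simp
    ring

variable (P : Type*) [PartialOrder P] [Finite P]

theorem exists_polynomial_multichains_from (x : P) :
    ∃ p : Polynomial ℚ, ∀ j : ℕ,
      p.eval (j : ℚ) = Nat.card {f : Fin (j + 1) → P // Monotone f ∧ f 0 = x} := by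
  classical
  have := Fintype.ofFinite P
  let g : ℕ → P → ℕ := fun j x => Nat.card {f : Fin (j + 1) → P // Monotone f ∧ f 0 = x}
  have h0 : ∀ x, g 0 x = 1 := by
    intro x
    refine Nat.card_eq_one_iff_unique.2 ⟨⟨?_⟩, ⟨⟨fun _ => x, monotone_const, rfl⟩⟩⟩
    rintro ⟨f, -, hf⟩ ⟨f', -, hf'⟩
    refine Subtype.ext (funext fun i => ?_)
    have : i = 0 := Fin.ext (by omega)
    subst this
    exact hf.trans hf'.symm
  have hs : ∀ j x, g (j + 1) x = ∑ y with x ≤ y, g j y := by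
    intro j x
    have e : {f : Fin (j + 1 + 1) → P // Monotone f ∧ f 0 = x} ≃
        Σ y : {y // x ≤ y}, {f : Fin (j + 1) → P // Monotone f ∧ f 0 = y.1} :=
      { toFun := fun f => ⟨⟨f.1 1, by
            have := f.2.1 (Fin.zero_le 1); rwa [f.2.2] at this⟩,
          ⟨fun i => f.1 i.succ, fun a b hab => f.2.1 (Fin.succ_le_succ_iff.2 hab), rfl⟩⟩
        invFun := fun s => ⟨Matrix.vecCons x s.2.1, by
            refine ⟨monotone_vecCons.2 ⟨?_, s.2.2.1⟩, rfl⟩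
            rw [s.2.2.2]; exact s.1.2⟩
        left_inv := by
          rintro ⟨f, hf, rfl⟩
          refine Subtype.ext (funext fun i => ?_)
          refine Fin.cases ?_ (fun i => ?_) i <;> rfl
        right_inv := by
          rintro ⟨⟨y, hy⟩, ⟨f, hf, h⟩⟩
          have h' : y = f 0 := h.symm
          subst h'
          rfl }
    show Nat.card _ = _
    rw [Nat.card_congr e, Nat.card_sigma]
    exact (Finset.sum_subtype (Finset.univ.filter fun y => x ≤ y) (by simp) (g j)).symm
  show ∃ p : Polynomial ℚ, ∀ j : ℕ, p.eval (j : ℚ) = (g j x : ℚ)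
  induction x using WellFoundedGT.induction with
  | _ x ih =>
    choose p hp using ih
    obtain ⟨q, hq⟩ := exists_polynomial_sum_range
      (∑ y : {y // x < y}, p y.1 y.2)
    refine ⟨1 + q, fun j => ?_⟩
    rw [Polynomial.eval_add, Polynomial.eval_one, hq]
    induction j with
    | zero => simp [h0]
    | succ j ihj =>
      rw [Finset.sum_range_succ, ← add_assoc, ihj, Polynomial.eval_finsetSum, hs]
      have : (Finset.univ.filter fun y => x ≤ y) =
          insert x (Finset.univ.filter fun y => x < y) := by
        ext y; simp [le_iff_eq_or_lt, eq_comm]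
      rw [this, Finset.sum_insert (by simp)]
      push_cast
      congr 1
      rw [Finset.sum_subtype (Finset.univ.filter fun y => x < y) (p := fun y => x < y) (by simp)]
      exact Finset.sum_congr rfl fun y _ => hp y.1 y.2 j

theorem exists_zetaPolynomial :
    ∃ Z : Polynomial ℚ, ∀ m : ℕ, 2 ≤ m → Z.eval (m : ℚ) = multichainCount P (m - 1) := by
  classical
  have := Fintype.ofFinite P
  choose p hp using exists_polynomial_multichains_from P
  refine ⟨(∑ x, p x).comp (Polynomial.X - 2), fun m hm => ?_⟩
  obtain ⟨j, rfl⟩ := Nat.exists_eq_add_of_le' hm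
  have e : (Fin (j + 1) →o P) ≃ Σ x : P, {f : Fin (j + 1) → P // Monotone f ∧ f 0 = x} :=
    { toFun := fun f => ⟨f 0, f, f.monotone, rfl⟩
      invFun := fun s => ⟨s.2.1, s.2.2.1⟩
      left_inv := fun _ => rfl
      right_inv := by
        rintro ⟨x, f, hf, rfl⟩
        rfl }
  have hj : j + 2 - 1 = j + 1 := rfl
  rw [multichainCount, hj, Nat.card_congr e, Nat.card_sigma, Polynomial.eval_comp,
    Polynomial.eval_finsetSum]
  push_cast
  refine Finset.sum_congr rfl fun x _ => ?_
  rw [← hp]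
  congr 1
  simp

/-- The zeta polynomial `Z(P, ·)` of a finite poset: the polynomial whose value at each integer
`m ≥ 2` is the number of multichains `x_1 ≤ x_2 ≤ ⋯ ≤ x_{m-1}` of `P`. -/
noncomputable def zetaPolynomial : Polynomial ℚ := (exists_zetaPolynomial P).choose

theorem zetaPolynomial_eval {m : ℕ} (hm : 2 ≤ m) :
    (zetaPolynomial P).eval (m : ℚ) = multichainCount P (m - 1) :=
  (exists_zetaPolynomial P).choose_spec m hm

theorem eq_zetaPolynomial {Z : Polynomial ℚ}
    (hZ : ∀ m : ℕ, 2 ≤ m → Z.eval (m : ℚ) = multichainCount P (m - 1)) :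
    Z = zetaPolynomial P := by
  refine Polynomial.eq_of_infinite_eval_eq _ _ (Set.Infinite.mono (s := Nat.cast '' Set.Ici 2) ?_
    ((Set.Ici_infinite 2).image Nat.cast_injective.injOn))
  rintro _ ⟨m, hm, rfl⟩
  exact (hZ m hm).trans (zetaPolynomial_eval P hm).symm

open scoped Classical in
/-- The Möbius number `μ(P) = μ_P(0̂, 1̂)` of a finite bounded poset. -/
noncomputable def mobiusNumber [BoundedOrder P] : ℤ :=
  letI := Fintype.ofFinite P
  letI : LocallyFiniteOrder P := Fintype.toLocallyFiniteOrder
  IncidenceAlgebra.mu ℤ (⊥ : P) (⊤ : P)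

end Zeta

/-! A multichain `x_1 ≤ ⋯ ≤ x_{m-1}` below `w` is the same as a factorization of `w` into `m`
factors whose lengths add up, so `Z` is governed by the `m`-th power of the sum of all elements of
`B_n` in the graded group algebra, where products with non-additive lengths are 0.

Fix a signed point `x`. Every `g` is uniquely `b * t` with `b` fixing `x` and `t` either trivial or
a reflection moving `x`, and lengths add. Hence the sum of all elements is (stabilizer sum) times
(star sum), and the two commute because the stabilizer permutes the reflections moving `x`. Taking
`m`-th powers separately (`starCount_self`) reduces the count for `w` to `m` steps, each peeling off
at most one reflection moving `x` (`starCount_succ`), until an element fixing `x` is left. The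
length is the codimension of the space of invariant odd functions (`len_add_fixDim`); invariants
that separate `x` from `y` rule out the reflections that cannot be peeled off.

Put `m = p + 1`, `T = 1 + z T^(p+1)` and `B = ∑ C((p+1)k, k) z^k`. Peeling splits a paired cycle
into two paired ones, so `j` steps give the coefficients of `T^j` (`starCount_mul_star`). A balanced
cycle splits into a balanced and a paired one or becomes paired, which gives `j T^(j-1) B`
(`starCount_mul_bal`), and `j = p + 1` yields `C(mk, k)`. In `[1,…,k][k+1]⋯[k+r]` with `r > 0`, peel
at a singleton `[x]`: it is deleted, or joined to another singleton, or joined to the long balanced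
cycle, each join producing a paired cycle. The resulting recursion in `r` (`facCount_hook`) is
solved by the closed form (`hookNum_succ`); the fraction `2rk/(k+1)` comes from summing the
coefficients of `T^0, …, T^p` (`sum_range_raney`).

Both sides are polynomials in `m`, so agreement at integers `m ≥ 2` suffices. The cardinality is
`Z(2)` and the Möbius number is `Z(-1)`, where the sign of `Z(𝓛_r, -1)` is `(-1)^r`. -/

/-! ### Reflections as elements `refl x y` acting on signed points -/

namespace AbsB

variable {n : ℕ}

instance : MulAction (AbsB n) (SignedPt n) where
  smul g x := g.toPerm x
  one_smul _ := rfl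
  mul_smul _ _ _ := rfl

theorem smul_neg_pt (g : AbsB n) (x : SignedPt n) : g • (-x) = -(g • x) := g.2 x

theorem ext_smul {g h : AbsB n} (H : ∀ x : SignedPt n, g • x = h • x) : g = h :=
  Subtype.ext (Perm.ext H)

/-- The map exchanging `x` with `y` and `-x` with `-y`. -/
def reflFun (x y z : SignedPt n) : SignedPt n :=
  if z = x then y else if z = y then x else if z = -x then -y else if z = -y then -x else z

theorem reflFun_left (x y : SignedPt n) : reflFun x y x = y := by simp [reflFun]

theorem reflFun_right (x y : SignedPt n) : reflFun x y y = x := by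
  by_cases h : y = x <;> simp [reflFun, h]

theorem reflFun_of_ne {x y z : SignedPt n} (h1 : z ≠ x) (h2 : z ≠ y) (h3 : z ≠ -x) (h4 : z ≠ -y) :
    reflFun x y z = z := by simp [reflFun, *]

theorem reflFun_neg (x y z : SignedPt n) : reflFun x y (-z) = -reflFun x y z := by
  have a := ne_neg x
  have b := ne_neg y
  have c : ∀ u v : SignedPt n, -u = v ↔ u = -v := fun u v => neg_eq_iff_eq_neg
  simp only [reflFun, c, neg_neg]
  split_ifs <;> simp_all

theorem reflFun_involutive (x y : SignedPt n) : Function.Involutive (reflFun x y) := by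
  intro z
  by_cases h1 : z = x
  · rw [h1, reflFun_left, reflFun_right]
  by_cases h2 : z = y
  · rw [h2, reflFun_right, reflFun_left]
  by_cases h3 : z = -x
  · rw [h3, reflFun_neg, reflFun_left, reflFun_neg, reflFun_right]
  by_cases h4 : z = -y
  · rw [h4, reflFun_neg, reflFun_right, reflFun_neg, reflFun_left]
  rw [reflFun_of_ne h1 h2 h3 h4, reflFun_of_ne h1 h2 h3 h4]

/-- The reflection exchanging `x` with `y` and `-x` with `-y`; it is the identity for `y = x`. -/
def refl (x y : SignedPt n) : AbsB n :=
  ⟨(reflFun_involutive x y).toPerm, reflFun_neg x y⟩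

theorem refl_smul (x y z : SignedPt n) : refl x y • z = reflFun x y z := rfl

@[simp] theorem refl_smul_left (x y : SignedPt n) : refl x y • x = y := reflFun_left x y

@[simp] theorem refl_smul_right (x y : SignedPt n) : refl x y • y = x := reflFun_right x y

theorem refl_smul_of_ne {x y z : SignedPt n} (h1 : z ≠ x) (h2 : z ≠ y) (h3 : z ≠ -x) (h4 : z ≠ -y) :
    refl x y • z = z := reflFun_of_ne h1 h2 h3 h4

@[simp] theorem refl_mul_self (x y : SignedPt n) : refl x y * refl x y = 1 :=
  ext_smul fun z => reflFun_involutive x y z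

@[simp] theorem refl_mul_self_assoc (x y : SignedPt n) (g : AbsB n) :
    refl x y * (refl x y * g) = g := by
  rw [← mul_assoc, refl_mul_self, one_mul]

@[simp] theorem refl_inv (x y : SignedPt n) : (refl x y)⁻¹ = refl x y :=
  inv_eq_of_mul_eq_one_left (refl_mul_self x y)

theorem conj_refl (g : AbsB n) (x y : SignedPt n) :
    g * refl x y * g⁻¹ = refl (g • x) (g • y) := by
  rw [mul_inv_eq_iff_eq_mul]
  refine ext_smul fun z => ?_
  simp only [mul_smul, refl_smul, reflFun, ← smul_neg_pt, smul_left_cancel_iff]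
  split_ifs <;> rfl

theorem mul_refl (g : AbsB n) (x y : SignedPt n) :
    g * refl x y = refl (g • x) (g • y) * g := by
  rw [← conj_refl, inv_mul_cancel_right]

theorem refl_comm (x y : SignedPt n) : refl x y = refl y x := by
  have := conj_refl (refl x y) x y
  simpa using this

theorem refl_neg_neg (x y : SignedPt n) : refl (-x) (-y) = refl x y := by
  refine ext_smul fun z => ?_
  rw [refl_smul, refl_smul]
  by_cases h3 : z = -x
  · rw [h3, reflFun_left, reflFun_neg, reflFun_left]
  by_cases h4 : z = -y
  · rw [h4, reflFun_right, reflFun_neg, reflFun_right]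
  by_cases h1 : z = x
  · rw [h1, reflFun_left]
    have := reflFun_neg (-x) (-y) (-x)
    rwa [reflFun_left, neg_neg, neg_neg] at this
  by_cases h2 : z = y
  · rw [h2, reflFun_right]
    have := reflFun_neg (-x) (-y) (-y)
    rwa [reflFun_right, neg_neg, neg_neg] at this
  rw [reflFun_of_ne h1 h2 h3 h4, reflFun_of_ne h3 h4 (by rwa [neg_neg]) (by rwa [neg_neg])]

theorem refl_neg_left (x y : SignedPt n) : refl (-x) y = refl x (-y) := by
  rw [← refl_neg_neg x (-y), neg_neg]

@[simp] theorem refl_self (x : SignedPt n) : refl x x = 1 := by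
  refine ext_smul fun z => ?_
  rw [one_smul, refl_smul, reflFun]
  split_ifs <;> simp_all

theorem smul_eq_of_neg {g : AbsB n} {x : SignedPt n} (h : g • x = x) : g • (-x) = -x := by
  rw [smul_neg_pt, h]

/-- An element fixing `x` and `y` commutes with the reflection exchanging them. -/
theorem commute_refl {g : AbsB n} {x y : SignedPt n} (hx : g • x = x) (hy : g • y = y) :
    Commute g (refl x y) := by
  rw [commute_iff_eq, mul_refl, hx, hy]

theorem toPerm_refl_neg (x : SignedPt n) : (refl x (-x)).toPerm = swap x (-x) := by
  refine Perm.ext fun z => ?_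
  change reflFun x (-x) z = _
  rw [reflFun, swap_apply_def]
  split_ifs <;> simp_all

theorem toPerm_refl {x y : SignedPt n} (hy : y ≠ -x) :
    (refl x y).toPerm = swap x y * swap (-x) (-y) := by
  refine Perm.ext fun z => ?_
  change reflFun x y z = swap x y (swap (-x) (-y) z)
  have hx : x ≠ -y := fun h => hy (by rw [h, neg_neg])
  have a := ne_neg x
  have b := ne_neg y
  by_cases h3 : z = -x
  · rw [h3, reflFun_neg, reflFun_left, swap_apply_left, swap_apply_of_ne_of_ne hx.symm b.symm]
  by_cases h4 : z = -y
  · rw [h4, reflFun_neg, reflFun_right, swap_apply_right, swap_apply_of_ne_of_ne a.symm hy.symm]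
  rw [swap_apply_of_ne_of_ne h3 h4]
  by_cases h1 : z = x
  · rw [h1, reflFun_left, swap_apply_left]
  by_cases h2 : z = y
  · rw [h2, reflFun_right, swap_apply_right]
  rw [reflFun_of_ne h1 h2 h3 h4, swap_apply_of_ne_of_ne h1 h2]

theorem exists_refl_of_mem {t : AbsB n} (ht : t ∈ reflections n) :
    ∃ x y, x ≠ y ∧ t = refl x y := by
  have key : ∀ x y : SignedPt n, y ≠ -x → t.toPerm = pairedCycle [x, y] → t = refl x y := by
    intro x y h h'
    refine Subtype.ext (h'.trans ?_)
    change _ = (refl x y).toPerm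
    rw [toPerm_refl h]
    simp [pairedCycle]
  rcases ht with ⟨i, hi⟩ | ⟨i, j, hij, hi | hi⟩
  · refine ⟨pos i, -pos i, ne_neg _, Subtype.ext (hi.trans ?_)⟩
    change _ = (refl (pos i) (-pos i)).toPerm
    rw [toPerm_refl_neg]
    simp [balancedCycle]
  · exact ⟨_, _, fun h => hij.ne (pos_injective h), key _ _ (pos_ne_neg_pos _ _) hi⟩
  · exact ⟨_, _, pos_ne_neg_pos _ _,
      key _ _ (fun h => hij.ne (pos_injective (neg_injective h)).symm) hi⟩

theorem refl_mem {x y : SignedPt n} (h : x ≠ y) : refl x y ∈ reflections n := by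
  obtain ⟨t, ht, h1, h2⟩ := exists_reflection x y h
  have h1' : t • y = x := h1
  have h3 : t • x = y := by
    obtain ⟨a, b, -, rfl⟩ := exists_refl_of_mem ht
    have := congrArg (fun z => refl a b • z) h1'
    simp only [← mul_smul, refl_mul_self, one_smul] at this
    exact this.symm
  have : t = refl x y := by
    refine ext_smul fun z => ?_
    by_cases e1 : z = x
    · rw [e1, h3, refl_smul_left]
    by_cases e2 : z = y
    · rw [e2, h1', refl_smul_right]
    by_cases e3 : z = -x
    · rw [e3, smul_neg_pt, smul_neg_pt, h3, refl_smul_left]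
    by_cases e4 : z = -y
    · rw [e4, smul_neg_pt, smul_neg_pt, h1', refl_smul_right]
    rw [refl_smul_of_ne e1 e2 e3 e4]
    exact h2 z e1 e2 e3 e4
  rwa [← this]

end AbsB

/-! ### Absolute length as the codimension of the invariant odd functions -/

namespace AbsB

variable {n : ℕ}

/-- The odd functions on `{±1, …, ±n}` that are invariant under `w`. -/
def invts (w : AbsB n) : Submodule ℚ (SignedPt n → ℚ) where
  carrier := {f | (∀ z, f (-z) = -f z) ∧ ∀ z, f (w • z) = f z}
  add_mem' {f g} hf hg := ⟨fun z => by simp [hf.1 z, hg.1 z]; ring, fun z => by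
    simp [hf.2 z, hg.2 z]⟩
  zero_mem' := ⟨fun z => by simp, fun z => rfl⟩
  smul_mem' c f hf := ⟨fun z => by simp [hf.1 z], fun z => by simp [hf.2 z]⟩

theorem mem_invts {w : AbsB n} {f : SignedPt n → ℚ} :
    f ∈ invts w ↔ (∀ z, f (-z) = -f z) ∧ ∀ z, f (w • z) = f z := Iff.rfl

theorem mem_invts_one {f : SignedPt n → ℚ} : f ∈ invts (1 : AbsB n) ↔ ∀ z, f (-z) = -f z := by
  simp [mem_invts]

theorem mem_invts_mul {u v : AbsB n} {f : SignedPt n → ℚ} (hu : f ∈ invts u) (hv : f ∈ invts v) :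
    f ∈ invts (u * v) :=
  ⟨hu.1, fun z => by rw [mul_smul, hu.2, hv.2]⟩

theorem mem_invts_refl {x y : SignedPt n} {f : SignedPt n → ℚ} :
    f ∈ invts (refl x y) ↔ (∀ z, f (-z) = -f z) ∧ f x = f y := by
  refine and_congr_right fun hf => ⟨fun h => ?_, fun h z => ?_⟩
  · simpa using (h x).symm
  · by_cases e1 : z = x
    · rw [e1, refl_smul_left, h]
    by_cases e2 : z = y
    · rw [e2, refl_smul_right, h]
    by_cases e3 : z = -x
    · rw [e3, smul_neg_pt, refl_smul_left, hf, hf, h]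
    by_cases e4 : z = -y
    · rw [e4, smul_neg_pt, refl_smul_right, hf, hf, h]
    rw [refl_smul_of_ne e1 e2 e3 e4]

theorem invts_le_one (w : AbsB n) : invts w ≤ invts 1 := fun _ hf => mem_invts_one.2 hf.1

/-- The odd indicator function of a list of signed points. -/
def oddInd (l : List (SignedPt n)) (z : SignedPt n) : ℚ :=
  (if z ∈ l then 1 else 0) - (if -z ∈ l then 1 else 0)

theorem oddInd_neg (l : List (SignedPt n)) (z : SignedPt n) : oddInd l (-z) = -oddInd l z := by
  simp [oddInd]

theorem oddInd_singleton_self (x : SignedPt n) : oddInd [x] x = 1 := by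
  simp [oddInd, (ne_neg x).symm]

theorem oddInd_singleton_ne {x z : SignedPt n} (h : z ≠ x) : oddInd [x] z ≠ 1 := by
  simp only [oddInd, List.mem_singleton, h, if_false]
  split_ifs <;> norm_num

theorem smul_mem_iff {g : AbsB n} {l : List (SignedPt n)} (h : ∀ x ∈ l, g • x = x)
    (z : SignedPt n) : g • z ∈ l ↔ z ∈ l := by
  refine ⟨fun hz => ?_, fun hz => by rwa [h z hz]⟩
  have := h _ hz
  rw [smul_left_cancel_iff] at this
  rwa [this] at hz

theorem oddInd_mem_invts {g : AbsB n} {l : List (SignedPt n)} (h : ∀ x ∈ l, g • x = x) :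
    oddInd l ∈ invts g :=
  ⟨oddInd_neg l, fun z => by simp only [oddInd, ← smul_neg_pt, smul_mem_iff h]⟩

/-- The dimension of the space of invariant odd functions. -/
noncomputable def fixDim (w : AbsB n) : ℕ := Module.finrank ℚ (invts w)

theorem fixDim_le_one (w : AbsB n) : fixDim w ≤ fixDim (1 : AbsB n) :=
  Submodule.finrank_mono (invts_le_one w)

theorem fixDim_add_le (u v : AbsB n) :
    fixDim u + fixDim v ≤ fixDim (1 : AbsB n) + Module.finrank ℚ ↥(invts u ⊓ invts v) := by
  rw [fixDim, fixDim, ← Submodule.finrank_sup_add_finrank_inf_eq]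
  exact Nat.add_le_add_right (Submodule.finrank_mono (sup_le (invts_le_one u) (invts_le_one v))) _

theorem inf_le_invts_mul (u v : AbsB n) : invts u ⊓ invts v ≤ invts (u * v) :=
  fun _ hf => mem_invts_mul hf.1 hf.2

/-- Subadditivity of codimension: common invariants of `u` and `v` are invariant under `u * v`, and
the dimension formula bounds their intersection from below. -/
theorem fixDim_add_le_mul (u v : AbsB n) :
    fixDim u + fixDim v ≤ fixDim (1 : AbsB n) + fixDim (u * v) :=
  (fixDim_add_le u v).trans (Nat.add_le_add_left (Submodule.finrank_mono (inf_le_invts_mul u v)) _)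

theorem fixDim_refl (x y : SignedPt n) : fixDim (1 : AbsB n) ≤ fixDim (refl x y) + 1 := by
  let φ : ↥(invts (1 : AbsB n)) →ₗ[ℚ] ℚ :=
    { toFun := fun f => f.1 x - f.1 y
      map_add' := fun f g => by simp; ring
      map_smul' := fun c f => by simp; ring }
  have h1 := φ.finrank_range_add_finrank_ker
  have h2 : Module.finrank ℚ φ.range ≤ 1 :=
    (Submodule.finrank_le _).trans (by simp)
  have h3 : Module.finrank ℚ φ.ker ≤ fixDim (refl x y) := by
    rw [← Submodule.finrank_map_subtype_eq]
    refine Submodule.finrank_mono ?_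
    rintro _ ⟨f, hf, rfl⟩
    exact mem_invts_refl.2 ⟨f.2.1, sub_eq_zero.1 hf⟩
  change _ = fixDim (1 : AbsB n) at h1
  omega

/-- The absolute length of an element of `B_n`. -/
noncomputable abbrev len (w : AbsB n) : ℕ := absLength (reflections n) w

theorem len_one : len (1 : AbsB n) = 0 := absLength_one

theorem len_mul_le (u v : AbsB n) : len (u * v) ≤ len u + len v :=
  absLength_mul_le exists_list_reflections u v

theorem len_refl_le (x y : SignedPt n) : len (refl x y) ≤ 1 := by
  by_cases h : x = y
  · rw [h, refl_self, len_one]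
    exact zero_le_one
  · simpa using absLength_le (T := reflections n) (l := [refl x y]) (by simpa using refl_mem h)

theorem fixDim_one_le_prod {l : List (AbsB n)} (h : ∀ t ∈ l, t ∈ reflections n) :
    fixDim (1 : AbsB n) ≤ fixDim l.prod + l.length := by
  induction l with
  | nil => simp
  | cons t l ih =>
    have h1 := ih fun s hs => h s (List.mem_cons_of_mem _ hs)
    obtain ⟨x, y, -, rfl⟩ := exists_refl_of_mem (h t List.mem_cons_self)
    have h2 := fixDim_refl x y
    have h3 := fixDim_add_le_mul (refl x y) l.prod
    rw [List.prod_cons, List.length_cons]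
    omega

/-- No invariant is lost, since invariants of `w` agree at `x` and `w⁻¹ • x`. The odd indicator of
`x` is gained, because the new product fixes `x`. -/
theorem invts_lt_mul_refl {w : AbsB n} {x : SignedPt n} (hx : w • x ≠ x) :
    invts w < invts (w * refl x (w⁻¹ • x)) := by
  have hle : invts w ≤ invts (w * refl x (w⁻¹ • x)) := fun f hf => by
    refine mem_invts_mul hf (mem_invts_refl.2 ⟨hf.1, ?_⟩)
    rw [← hf.2 (w⁻¹ • x), smul_inv_smul]
  refine lt_of_le_of_ne hle fun h => ?_
  have h1 : oddInd [x] ∈ invts (w * refl x (w⁻¹ • x)) := by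
    refine oddInd_mem_invts ?_
    simp [mul_smul]
  rw [← h] at h1
  have h2 := h1.2 x
  rw [oddInd_singleton_self] at h2
  exact oddInd_singleton_ne hx h2

/-- A reflection lowers the dimension of invariants by at most one, which bounds the length from
below. Conversely, as long as some point is moved, one reflection enlarges the space of invariants.
-/
theorem len_add_fixDim (w : AbsB n) : len w + fixDim w = fixDim (1 : AbsB n) := by
  apply le_antisymm
  · induction h : fixDim (1 : AbsB n) - fixDim w using Nat.strong_induction_on generalizing w with
    | _ m ih =>
      by_cases hw : ∃ x : SignedPt n, w • x ≠ x
      · obtain ⟨x, hx⟩ := hw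
        have h1 : fixDim w < fixDim (w * refl x (w⁻¹ • x)) :=
          Submodule.finrank_lt_finrank_of_lt (invts_lt_mul_refl hx)
        have h2 := fixDim_le_one (w * refl x (w⁻¹ • x))
        have h3 := ih _ (by omega) (w * refl x (w⁻¹ • x)) rfl
        have h4 := len_mul_le (w * refl x (w⁻¹ • x)) (refl x (w⁻¹ • x))
        rw [mul_assoc, refl_mul_self, mul_one] at h4
        have h5 := len_refl_le x (w⁻¹ • x)
        omega
      · push Not at hw
        have : w = 1 := ext_smul fun x => by rw [hw, one_smul]
        rw [this, len_one, zero_add]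
  · obtain ⟨l, h1, h2, h3⟩ := exists_list_absLength (exists_list_reflections w)
    have := fixDim_one_le_prod h1
    rw [h2, h3] at this
    rw [add_comm]
    exact this

/-- The permutation of the absolute values. -/
def absPerm : AbsB n →* Perm (Fin n) where
  toFun w :=
    { toFun := fun i => (w • pos i).1
      invFun := fun i => (w⁻¹ • pos i).1
      left_inv := fun i => by
        rcases eq_pos_or (w • pos i) with h | h
        · dsimp only; rw [← h, inv_smul_smul]; rfl
        · have h' : pos (w • pos i).1 = -(w • pos i) := by conv_rhs => rw [h, neg_neg]
          dsimp only; rw [h', smul_neg_pt, inv_smul_smul]; rfl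
      right_inv := fun i => by
        rcases eq_pos_or (w⁻¹ • pos i) with h | h
        · dsimp only; rw [← h, smul_inv_smul]; rfl
        · have h' : pos (w⁻¹ • pos i).1 = -(w⁻¹ • pos i) := by conv_rhs => rw [h, neg_neg]
          dsimp only; rw [h', smul_neg_pt, smul_inv_smul]; rfl }
  map_one' := by ext; rfl
  map_mul' u v := Perm.ext fun i => by
    change (u • (v • pos i)).1 = (u • pos (v • pos i).1).1
    rcases eq_pos_or (v • pos i) with h | h
    · rw [← h]
    · have h' : pos (v • pos i).1 = -(v • pos i) := by conv_rhs => rw [h, neg_neg]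
      rw [h', smul_neg_pt]; rfl

/-- The determinant of a signed permutation. -/
def detSign : AbsB n →* ℤˣ where
  toFun w := Perm.sign w.toPerm * Perm.sign (absPerm w)
  map_one' := by
    rw [map_one]
    change Perm.sign (1 : Perm (SignedPt n)) * _ = 1
    simp
  map_mul' u v := by
    rw [map_mul]
    change Perm.sign (u.toPerm * v.toPerm) * _ = _
    rw [map_mul, map_mul, mul_mul_mul_comm]

theorem absPerm_apply (w : AbsB n) (i : Fin n) : absPerm w i = (w • pos i).1 := rfl

theorem neg_fst (x : SignedPt n) : (-x).1 = x.1 := rfl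

theorem fst_eq_iff {x y : SignedPt n} : x.1 = y.1 ↔ x = y ∨ x = -y := by
  constructor
  · intro h
    rcases eq_pos_or x with hx | hx <;> rcases eq_pos_or y with hy | hy <;>
      rw [hx, hy, h] <;> simp
  · rintro (rfl | rfl) <;> rfl

theorem absPerm_refl (x y : SignedPt n) : absPerm (refl x y) = swap x.1 y.1 := by
  refine Perm.ext fun i => ?_
  rw [absPerm_apply]
  by_cases h1 : pos i = x
  · rw [h1, ← h1, refl_smul_left, h1]; exact (swap_apply_left x.1 y.1).symm.trans (by rw [← h1]; rfl)
  by_cases h2 : pos i = y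
  · rw [h2, refl_smul_right]; exact (swap_apply_right x.1 y.1).symm.trans (by rw [← h2]; rfl)
  by_cases h3 : pos i = -x
  · rw [h3, smul_neg_pt, refl_smul_left, neg_fst]
    have : i = x.1 := congrArg Prod.fst h3
    rw [this, swap_apply_left]
  by_cases h4 : pos i = -y
  · rw [h4, smul_neg_pt, refl_smul_right, neg_fst]
    have : i = y.1 := congrArg Prod.fst h4
    rw [this, swap_apply_right]
  rw [refl_smul_of_ne h1 h2 h3 h4, swap_apply_of_ne_of_ne]
  · rfl
  · intro h
    rcases fst_eq_iff.1 (show (pos i).1 = x.1 from h) with h | h <;> contradiction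
  · intro h
    rcases fst_eq_iff.1 (show (pos i).1 = y.1 from h) with h | h <;> contradiction

theorem detSign_refl {x y : SignedPt n} (h : x ≠ y) : detSign (refl x y) = -1 := by
  change Perm.sign (refl x y).toPerm * Perm.sign (absPerm (refl x y)) = -1
  rw [absPerm_refl]
  by_cases hy : y = -x
  · rw [hy, toPerm_refl_neg, Perm.sign_swap (ne_neg x), neg_fst, swap_self]
    simp
  · rw [toPerm_refl hy, map_mul, Perm.sign_swap h, Perm.sign_swap (fun e => h (neg_injective e)),
      Perm.sign_swap]
    · simp
    · intro e
      rcases fst_eq_iff.1 e with e | e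
      · exact h e
      · exact hy (by rw [e, neg_neg])

theorem detSign_eq (w : AbsB n) : detSign w = (-1) ^ len w := by
  obtain ⟨l, h1, h2, h3⟩ := exists_list_absLength (exists_list_reflections w)
  rw [len, ← h3, ← h2]
  clear h2 h3
  induction l with
  | nil => simp
  | cons t l ih =>
    obtain ⟨x, y, hxy, rfl⟩ := exists_refl_of_mem (h1 t List.mem_cons_self)
    rw [List.prod_cons, map_mul, ih fun s hs => h1 s (List.mem_cons_of_mem _ hs),
      detSign_refl hxy, List.length_cons, pow_succ, mul_comm]

/-- The determinant equals `(-1) ^ len`, so a reflection changes the parity of the length. -/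
theorem len_mul_refl_ne (w : AbsB n) {x y : SignedPt n} (h : x ≠ y) :
    len (w * refl x y) ≠ len w := by
  intro e
  have h1 := detSign_eq (w * refl x y)
  rw [map_mul, detSign_refl h, e, detSign_eq w, mul_neg, mul_one] at h1
  exact units_ne_neg_self _ h1.symm

theorem len_mul_refl (w : AbsB n) {x y : SignedPt n} (h : x ≠ y) :
    len (w * refl x y) = len w + 1 ∨ len (w * refl x y) + 1 = len w := by
  have h1 := len_mul_le w (refl x y)
  have h2 := len_mul_le (w * refl x y) (refl x y)
  rw [mul_assoc, refl_mul_self, mul_one] at h2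
  have h3 := len_refl_le x y
  have h4 := len_mul_refl_ne w h
  omega

theorem len_refl {x y : SignedPt n} (h : x ≠ y) : len (refl x y) = 1 := by
  have h1 := len_mul_refl 1 h
  rw [one_mul, len_one] at h1
  omega

/-- Additive lengths force equality in the codimension estimate, so the inclusion of the common
invariants into `invts w` is an equality of dimensions. -/
theorem invts_le_of_len_add {u v w : AbsB n} (h : u * v = w) (hl : len u + len v = len w) :
    invts w ≤ invts u ⊓ invts v := by
  have h1 := len_add_fixDim u
  have h2 := len_add_fixDim v
  have h3 := len_add_fixDim w
  have h4 := fixDim_add_le u v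
  have h5 := inf_le_invts_mul u v
  rw [h] at h5
  refine (Submodule.eq_of_le_of_finrank_le h5 ?_).ge
  change fixDim w ≤ _
  omega

/-- Were the length to drop, `w` would factor additively through `refl x y`, and every invariant of
`w` would take equal values at `x` and `y`. This is the test that excludes reflections from the
peeling step. -/
theorem len_mul_refl_of_mem {w : AbsB n} {x y : SignedPt n} {f : SignedPt n → ℚ}
    (hf : f ∈ invts w) (hxy : f x ≠ f y) : len (w * refl x y) = len w + 1 := by
  have hne : x ≠ y := fun h => hxy (by rw [h])
  refine (len_mul_refl w hne).resolve_right fun h => hxy ?_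
  have := invts_le_of_len_add (u := w * refl x y) (v := refl x y) (w := w) (by simp [mul_assoc])
    (by rw [len_refl hne, h]) hf
  exact (mem_invts_refl.1 this.2).2

theorem len_mul_refl_of_smul {w : AbsB n} {x y : SignedPt n} (hy : w • y = y) (hxy : x ≠ y) :
    len (w * refl x y) = len w + 1 := by
  refine len_mul_refl_of_mem (oddInd_mem_invts (l := [y]) (by simpa using hy)) ?_
  rw [oddInd_singleton_self]
  exact oddInd_singleton_ne hxy

theorem smul_eq_of_mem_invts {w : AbsB n} {x : SignedPt n} (h : oddInd [x] ∈ invts w) :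
    w • x = x := by
  by_contra hx
  have h2 := h.2 x
  rw [oddInd_singleton_self] at h2
  exact oddInd_singleton_ne hx h2

theorem smul_eq_of_len_add {u v w : AbsB n} (h : u * v = w) (hl : len u + len v = len w)
    {x : SignedPt n} (hx : w • x = x) : u • x = x ∧ v • x = x := by
  have := invts_le_of_len_add h hl (oddInd_mem_invts (l := [x]) (by simpa using hx))
  exact ⟨smul_eq_of_mem_invts this.1, smul_eq_of_mem_invts this.2⟩

theorem len_conj_le (g w : AbsB n) : len (g * w * g⁻¹) ≤ len w := by
  obtain ⟨l, h1, h2, h3⟩ := exists_list_absLength (exists_list_reflections w)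
  have := absLength_le (T := reflections n) (l := l.map (MulAut.conj g)) (by
    intro t ht
    obtain ⟨s, hs, rfl⟩ := List.mem_map.1 ht
    obtain ⟨x, y, hxy, rfl⟩ := exists_refl_of_mem (h1 s hs)
    rw [MulAut.conj_apply, conj_refl]
    exact refl_mem (by simpa using hxy))
  rw [← map_list_prod, h2, List.length_map, h3] at this
  exact this

theorem len_conj (g w : AbsB n) : len (g * w * g⁻¹) = len w := by
  refine le_antisymm (len_conj_le g w) ?_
  have := len_conj_le g⁻¹ (g * w * g⁻¹)
  simpa [mul_assoc] using this

end AbsB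

/-! ### Length-additive factorizations and the star decomposition -/

namespace AbsB

variable {n : ℕ}

noncomputable instance : Fintype (AbsB n) := Fintype.ofFinite _

noncomputable instance : DecidableEq (AbsB n) := Classical.decEq _

/-- Convolution with the indicator function of `s` in the associated graded algebra of the group
algebra of `B_n` filtered by the absolute length. -/
noncomputable def conv (s : Finset (AbsB n)) : Module.End ℚ (AbsB n → ℚ) where
  toFun f w := ∑ v ∈ s, if len (w * v⁻¹) + len v = len w then f (w * v⁻¹) else 0
  map_add' f g := by
    funext w
    simp only [Pi.add_apply, ← Finset.sum_add_distrib]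
    refine Finset.sum_congr rfl fun v _ => ?_
    split_ifs <;> simp
  map_smul' c f := by
    funext w
    simp only [Pi.smul_apply, Finset.smul_sum, RingHom.id_apply]
    refine Finset.sum_congr rfl fun v _ => ?_
    split_ifs <;> simp

theorem conv_apply (s : Finset (AbsB n)) (f : AbsB n → ℚ) (w : AbsB n) :
    conv s f w = ∑ v ∈ s, if len (w * v⁻¹) + len v = len w then f (w * v⁻¹) else 0 := rfl

theorem conv_mul_apply (s t : Finset (AbsB n)) (f : AbsB n → ℚ) (w : AbsB n) :
    (conv s * conv t) f w = ∑ p ∈ s ×ˢ t,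
      if len (w * (p.2 * p.1)⁻¹) + len p.2 + len p.1 = len w then f (w * (p.2 * p.1)⁻¹) else 0 := by
  rw [Module.End.mul_apply, conv_apply, Finset.sum_product]
  refine Finset.sum_congr rfl fun a _ => ?_
  rw [conv_apply]
  have e : ∀ b, w * (b * a)⁻¹ = w * a⁻¹ * b⁻¹ := fun b => by group
  simp only [e]
  have h1 := len_mul_le (w * a⁻¹) a
  rw [inv_mul_cancel_right] at h1
  split_ifs with h
  · refine Finset.sum_congr rfl fun b _ => ?_
    congr 1
    exact propext ⟨fun _ => by omega, fun _ => by omega⟩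
  · symm
    refine Finset.sum_eq_zero fun b _ => ?_
    rw [if_neg]
    have h2 := len_mul_le (w * a⁻¹ * b⁻¹) b
    rw [inv_mul_cancel_right] at h2
    omega

/-- The reflections moving `x`, together with the identity. -/
noncomputable def stars (x : SignedPt n) : Finset (AbsB n) := Finset.univ.image (refl x)

/-- The stabilizer of `x`. -/
noncomputable def fixers (x : SignedPt n) : Finset (AbsB n) := {v | v • x = x}

theorem mem_fixers {x : SignedPt n} {v : AbsB n} : v ∈ fixers x ↔ v • x = x := by simp [fixers]

theorem mem_stars {x : SignedPt n} {v : AbsB n} : v ∈ stars x ↔ ∃ y, refl x y = v := by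
  simp [stars]

/-- Each `g` is uniquely `b * refl x y` with `b` fixing `x`: necessarily `y = g⁻¹ • x`. Lengths add
because `b` fixes `x`. -/
theorem conv_stars_mul_fixers (x : SignedPt n) :
    conv (stars x) * conv (fixers x) = conv Finset.univ := by
  refine LinearMap.ext fun f => funext fun w => ?_
  rw [conv_mul_apply, conv_apply]
  refine Finset.sum_nbij' (fun p => p.2 * p.1)
    (fun g => (refl x (g⁻¹ • x), g * refl x (g⁻¹ • x))) (fun _ _ => Finset.mem_univ _) ?_ ?_ ?_ ?_
  · intro g _
    rw [Finset.mem_product]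
    refine ⟨mem_stars.2 ⟨_, rfl⟩, mem_fixers.2 ?_⟩
    simp [mul_smul]
  · rintro ⟨a, b⟩ h
    obtain ⟨ha, hb⟩ := Finset.mem_product.1 h
    obtain ⟨y, rfl⟩ := mem_stars.1 ha
    have hb' : b⁻¹ • x = x := inv_smul_eq_iff.2 (mem_fixers.1 hb).symm
    dsimp only
    simp [mul_smul, hb', mul_assoc]
  · intro g _
    simp [mul_assoc]
  · rintro ⟨a, b⟩ h
    obtain ⟨ha, hb⟩ := Finset.mem_product.1 h
    obtain ⟨y, rfl⟩ := mem_stars.1 ha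
    have : len (b * refl x y) = len b + len (refl x y) := by
      by_cases hxy : x = y
      · subst hxy
        simp [len_one]
      · rw [len_refl hxy, refl_comm]
        exact len_mul_refl_of_smul (mem_fixers.1 hb) (Ne.symm hxy)
    dsimp only
    rw [this, add_assoc]

/-- Conjugation by an element fixing `x` permutes the reflections moving `x` and preserves length.
-/
theorem conv_stars_commute (x : SignedPt n) : Commute (conv (stars x)) (conv (fixers x)) := by
  refine LinearMap.ext fun f => funext fun w => ?_
  rw [conv_mul_apply, conv_mul_apply]
  refine Finset.sum_nbij' (fun p => (p.2, p.2 * p.1 * p.2⁻¹)) (fun p => (p.1⁻¹ * p.2 * p.1, p.1))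
    ?_ ?_ ?_ ?_ ?_
  · rintro ⟨a, b⟩ h
    obtain ⟨ha, hb⟩ := Finset.mem_product.1 h
    obtain ⟨y, rfl⟩ := mem_stars.1 ha
    refine Finset.mem_product.2 ⟨hb, mem_stars.2 ⟨b • y, ?_⟩⟩
    rw [conj_refl, mem_fixers.1 hb]
  · rintro ⟨b, a⟩ h
    obtain ⟨hb, ha⟩ := Finset.mem_product.1 h
    obtain ⟨y, rfl⟩ := mem_stars.1 ha
    refine Finset.mem_product.2 ⟨mem_stars.2 ⟨b⁻¹ • y, ?_⟩, hb⟩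
    have := conj_refl b⁻¹ x y
    rw [inv_inv] at this
    dsimp only
    rw [this, inv_smul_eq_iff.2 (mem_fixers.1 hb).symm]
  · rintro ⟨a, b⟩ _
    simp [mul_assoc]
  · rintro ⟨b, a⟩ _
    simp [mul_assoc]
  · rintro ⟨a, b⟩ _
    simp only [inv_mul_cancel_right, len_conj]
    congr 1
    exact propext ⟨fun _ => by omega, fun _ => by omega⟩

/-- The number of factorizations of `w` into `m` factors with additive lengths. -/
noncomputable def facCount (m : ℕ) : AbsB n → ℚ := (conv Finset.univ ^ m) (Pi.single 1 1)

theorem facCount_zero : facCount 0 = (Pi.single 1 1 : AbsB n → ℚ) := rfl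

theorem facCount_succ (m : ℕ) : (facCount (m + 1) : AbsB n → ℚ) = conv Finset.univ (facCount m) := by
  rw [facCount, pow_succ', Module.End.mul_apply, facCount]

theorem facCount_succ_apply (m : ℕ) (w : AbsB n) :
    facCount (m + 1) w = ∑ u ∈ (Set.toFinite (Set.Iic w)).toFinset, facCount m u := by
  classical
  rw [facCount_succ, conv_apply]
  have : (Set.toFinite (Set.Iic w)).toFinset = Finset.univ.filter (· ≤ w) := by ext; simp
  rw [this, Finset.sum_filter]
  refine Finset.sum_nbij' (fun v => w * v⁻¹) (fun u => u⁻¹ * w) ?_ ?_ ?_ ?_ ?_ <;>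
    simp [AbsB.le_iff, mul_assoc]

theorem facCount_one (w : AbsB n) : facCount 1 w = 1 := by
  have : (1 : AbsB n) ≤ w := (AbsB.instFactOneLe w).out
  rw [facCount_succ_apply, facCount_zero]
  simp [Pi.single_apply, this]

open scoped Classical in
/-- The restriction of a function to the stabilizer of `x`. -/
noncomputable def restr (x : SignedPt n) (f : AbsB n → ℚ) : AbsB n → ℚ :=
  fun w => if w • x = x then f w else 0

theorem restr_of_smul {x : SignedPt n} {w : AbsB n} (f : AbsB n → ℚ) (h : w • x = x) :
    restr x f w = f w := if_pos h

theorem restr_of_ne {x : SignedPt n} {w : AbsB n} (f : AbsB n → ℚ) (h : w • x ≠ x) :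
    restr x f w = 0 := if_neg h

/-- In a length-additive factorization of an element fixing `x`, both factors fix `x`. So convolving
inside the stabilizer loses nothing. -/
theorem conv_fixers_restr (x : SignedPt n) (f : AbsB n → ℚ) :
    conv (fixers x) (restr x f) = restr x (conv Finset.univ f) := by
  funext w
  rw [conv_apply]
  by_cases hw : w • x = x
  · rw [restr_of_smul _ hw, conv_apply, ← Finset.sum_subset (Finset.subset_univ (fixers x))]
    · refine Finset.sum_congr rfl fun v hv => ?_
      rw [restr_of_smul]
      rw [mul_smul, inv_smul_eq_iff.2 (mem_fixers.1 hv).symm, hw]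
    · intro v _ hv
      rw [if_neg]
      intro h
      exact hv (mem_fixers.2 (smul_eq_of_len_add (inv_mul_cancel_right w v) h hw).2)
  · rw [restr_of_ne _ hw]
    refine Finset.sum_eq_zero fun v hv => ?_
    rw [restr_of_ne, ite_self]
    rwa [mul_smul, inv_smul_eq_iff.2 (mem_fixers.1 hv).symm]

theorem conv_fixers_pow_restr (x : SignedPt n) (f : AbsB n → ℚ) (m : ℕ) :
    (conv (fixers x) ^ m) (restr x f) = restr x ((conv Finset.univ ^ m) f) := by
  induction m with
  | zero => rfl
  | succ m ih =>
    rw [pow_succ', Module.End.mul_apply, ih, conv_fixers_restr, pow_succ', Module.End.mul_apply]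

/-- Factorizations into `m` factors fixing `x`, followed by `j` factors that are trivial or
reflections moving `x`. -/
noncomputable def starCount (m : ℕ) (x : SignedPt n) (j : ℕ) : AbsB n → ℚ :=
  (conv (stars x) ^ j) (restr x (facCount m))

theorem starCount_zero (m : ℕ) (x : SignedPt n) : starCount m x 0 = restr x (facCount m) := rfl

/-- Commutation separates the `m`-th power of the full sum into star and stabilizer powers. The
stabilizer power applied to the unit is the restricted count, since the unit is supported on the
stabilizer. -/
theorem starCount_self (m : ℕ) (x : SignedPt n) : starCount m x m = facCount m := by
  have h : restr x (Pi.single 1 1 : AbsB n → ℚ) = Pi.single 1 1 := by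
    funext w
    by_cases hw : w = 1
    · rw [hw, restr_of_smul _ (one_smul _ _)]
    · by_cases hx : w • x = x
      · rw [restr_of_smul _ hx]
      · rw [restr_of_ne _ hx, Pi.single_eq_of_ne hw]
  rw [starCount, facCount, ← conv_fixers_pow_restr, ← Module.End.mul_apply,
    ← (conv_stars_commute x).mul_pow, conv_stars_mul_fixers, h]

open scoped Classical in
-- The rightmost star factor is either trivial, giving the first term, or a reflection, which has
-- length one and must lower the length.
theorem starCount_succ (m : ℕ) (x : SignedPt n) (j : ℕ) (w : AbsB n) :
    starCount m x (j + 1) w = starCount m x j w +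
      ∑ y with y ≠ x ∧ len (w * refl x y) + 1 = len w, starCount m x j (w * refl x y) := by
  have hinj : Function.Injective (refl x) := fun y z h => by
    have := congrArg (fun g : AbsB n => g • x) h
    simpa using this
  rw [starCount, pow_succ', Module.End.mul_apply, ← starCount, conv_apply, stars,
    Finset.sum_image hinj.injOn, ← Finset.add_sum_erase _ _ (Finset.mem_univ x)]
  simp only [refl_self, inv_one, mul_one, len_one, add_zero, if_true, refl_inv]
  congr 1
  rw [← Finset.sum_filter]
  refine Finset.sum_congr ?_ fun _ _ => rfl
  ext y
  simp only [Finset.mem_filter, Finset.mem_erase, Finset.mem_univ, and_true, true_and]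
  refine and_congr_right fun h => ?_
  rw [len_refl h.symm]

end AbsB

/-! ### Coefficients of powers of `T = 1 + z T ^ (p + 1)` -/

section Numbers

/-- The coefficient of `z ^ k` in `T ^ j`, where `T = 1 + z T ^ (p + 1)`. -/
def raney (p j : ℕ) : ℕ → ℚ
  | 0 => 1
  | k + 1 => ((p + 1) * (k + 1) + j).choose (k + 1) - (p + 1) * ((p + 1) * k + p + j).choose k

theorem raney_zero_right (p j : ℕ) : raney p j 0 = 1 := rfl

theorem raney_zero_succ (p k : ℕ) : raney p 0 (k + 1) = 0 := by
  have h := Nat.add_one_mul_choose_eq ((p + 1) * k + p) k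
  have e : (p + 1) * k + p + 1 = (p + 1) * (k + 1) := by ring
  rw [e] at h
  have h' : ((p + 1 : ℚ) * (k + 1)) * ((p + 1) * k + p).choose k =
    ((p + 1) * (k + 1)).choose (k + 1) * (k + 1) := by exact_mod_cast h
  have hk : (k + 1 : ℚ) ≠ 0 := by positivity
  rw [raney, add_zero, add_zero, sub_eq_zero]
  refine mul_right_cancel₀ hk ?_
  rw [← h']
  ring

/-- Coefficient form of `T^(j+1) = T^j + z T^(j+p+1)`, by Pascal's rule in both binomials. -/
theorem raney_succ_succ (p j k : ℕ) :
    raney p (j + 1) (k + 1) = raney p j (k + 1) + raney p (j + p + 1) k := by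
  have e1 : (p + 1) * (k + 1) + (j + 1) = (p + 1) * k + (j + p + 1) + 1 := by ring
  have e2 : (p + 1) * (k + 1) + j = (p + 1) * k + (j + p + 1) := by ring
  cases k with
  | zero =>
    simp only [raney]
    simp
  | succ k =>
    have e3 : (p + 1) * (k + 1) + p + (j + 1) = (p + 1) * k + p + (j + p + 1) + 1 := by ring
    have e4 : (p + 1) * (k + 1) + p + j = (p + 1) * k + p + (j + p + 1) := by ring
    simp only [raney]
    rw [e1, e2, e3, e4, Nat.choose_succ_succ' _ (k + 1), Nat.choose_succ_succ' _ k]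
    push_cast
    ring

/-- This is `T^u * X_j = X_(u+j)` for any series obeying the recursion of the powers of `T`; it is
used for `X_j = T^j` and `X_j = T^j B`. The degree is the outer induction, because the recursion
raises the exponent by `p + 1` while lowering the degree. -/
theorem sum_raney_mul (p : ℕ) (X : ℕ → ℕ → ℚ) (h0 : ∀ j, X (j + 1) 0 = X j 0)
    (hX : ∀ j s, X (j + 1) (s + 1) = X j (s + 1) + X (j + p + 1) s) (s u j : ℕ) :
    ∑ i ∈ Finset.HasAntidiagonal.antidiagonal s, raney p u i.1 * X j i.2 = X (u + j) s := by
  induction s generalizing u with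
  | zero =>
    simp only [Finset.Nat.antidiagonal_zero, Finset.sum_singleton, raney_zero_right, one_mul]
    induction u with
    | zero => rw [zero_add]
    | succ u ih => rw [ih, ← h0]; congr 1; ring
  | succ s ih =>
    induction u with
    | zero =>
      rw [Finset.Nat.sum_antidiagonal_succ]
      simp [raney_zero_right, raney_zero_succ]
    | succ u ihu =>
      rw [Finset.Nat.sum_antidiagonal_succ] at ihu ⊢
      simp only [raney_succ_succ, add_mul, Finset.sum_add_distrib, ih, raney_zero_right] at ihu ⊢
      rw [← add_assoc, ihu]
      have e : u + 1 + j = u + j + 1 := by ring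
      have e' : u + p + 1 + j = u + j + p + 1 := by ring
      rw [e, e', hX]

/-- Coefficient form of `T^(j+1) = T^j + z T^(p+1) T^j`, the shape produced by splitting a paired
cycle. -/
theorem raney_rec (p j s : ℕ) : raney p (j + 1) s = raney p j s +
    ∑ i ∈ Finset.range s, raney p (p + 1) i * raney p j (s - 1 - i) := by
  cases s with
  | zero => simp [raney_zero_right]
  | succ s =>
    have := sum_raney_mul p (raney p) (fun _ => rfl) (raney_succ_succ p) s (p + 1) j
    rw [Finset.Nat.sum_antidiagonal_eq_sum_range_succ_mk] at this
    rw [raney_succ_succ, add_tsub_cancel_right, this]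
    congr 2
    ring

theorem choose_step (p j s : ℕ) : (((p + 1) * (s + 1) + (j + 1)).choose (s + 1) : ℚ) =
    ((p + 1) * (s + 1) + j).choose (s + 1) + ((p + 1) * s + (j + p + 1)).choose s := by
  have e1 : (p + 1) * (s + 1) + (j + 1) = (p + 1) * s + (j + p + 1) + 1 := by ring
  have e2 : (p + 1) * (s + 1) + j = (p + 1) * s + (j + p + 1) := by ring
  rw [e1, e2, Nat.choose_succ_succ']
  push_cast
  ring

theorem sum_raney_mul_choose (p s u j : ℕ) :
    ∑ i ∈ Finset.HasAntidiagonal.antidiagonal s, raney p u i.1 * ((p + 1) * i.2 + j).choose i.2 =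
      ((p + 1) * s + (u + j)).choose s :=
  sum_raney_mul p (fun j s => (((p + 1) * s + j).choose s : ℚ)) (by simp) (choose_step p) s u j

/-- The coefficient of `z ^ s` in `j T ^ (j - 1) B`, where `T = 1 + z T ^ (p + 1)` and
`B = ∑ ((p + 1) k).choose k * z ^ k`. -/
def balNum (p j s : ℕ) : ℚ := j * ((p + 1) * s + (j - 1)).choose s

theorem balNum_self (p s : ℕ) : balNum p (p + 1) s = ((p + 1) * (s + 1)).choose (s + 1) := by
  have h := Nat.add_one_mul_choose_eq ((p + 1) * s + p) s
  have e : (p + 1) * s + p + 1 = (p + 1) * (s + 1) := by ring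
  rw [e] at h
  have h' : ((p + 1 : ℚ) * (s + 1)) * ((p + 1) * s + p).choose s =
    ((p + 1) * (s + 1)).choose (s + 1) * (s + 1) := by exact_mod_cast h
  have hk : (s + 1 : ℚ) ≠ 0 := by positivity
  refine mul_right_cancel₀ hk ?_
  rw [← h', balNum]
  push_cast
  ring

/-- Coefficient form of `(j+1) T^j B = j T^(j-1) B + T^j + z T^(p+1) (j T^(j-1) B) + (B - 1) T^j`.
The last three terms match the ways of peeling a reflection off a balanced cycle. -/
theorem balNum_rec (p j s : ℕ) : balNum p (j + 1) s = balNum p j s + raney p j s +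
    ∑ i ∈ Finset.range s, (raney p (p + 1) i * balNum p j (s - 1 - i) +
      ((p + 1) * (i + 1)).choose (i + 1) * raney p j (s - 1 - i)) := by
  cases s with
  | zero => simp [balNum, raney_zero_right]
  | succ s =>
    have h1 := sum_raney_mul_choose p (s + 1) j 0
    rw [Finset.Nat.sum_antidiagonal_succ'] at h1
    rw [← Finset.Nat.sum_antidiagonal_swap, Finset.Nat.sum_antidiagonal_eq_sum_range_succ_mk] at h1
    have h2 := sum_raney_mul_choose p s (p + 1) (j - 1)
    rw [Finset.Nat.sum_antidiagonal_eq_sum_range_succ_mk] at h2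
    simp only [Prod.fst_swap, Prod.snd_swap, add_zero, Nat.choose_zero_right, Nat.cast_one,
      mul_one, mul_zero] at h1
    simp only [add_tsub_cancel_right, balNum, Finset.sum_add_distrib]
    have e : ∀ i, raney p (p + 1) i * (j * (((p + 1) * (s - i) + (j - 1)).choose (s - i) : ℚ)) =
        j * (raney p (p + 1) i * ((p + 1) * (s - i) + (j - 1)).choose (s - i)) := fun i => by ring
    simp only [e, ← Finset.mul_sum, h2]
    rw [show (∑ i ∈ Finset.range (s + 1), (((p + 1) * (i + 1)).choose (i + 1) : ℚ) *
      raney p j (s - i)) = ((p + 1) * (s + 1) + j).choose (s + 1) - raney p j (s + 1) by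
      rw [← h1, add_sub_cancel_left]
      exact Finset.sum_congr rfl fun i _ => mul_comm _ _]
    cases j with
    | zero => simp
    | succ j =>
      have h3 := choose_step p j s
      have e : p + 1 + j = j + p + 1 := by ring
      rw [add_tsub_cancel_right, e, h3]
      push_cast
      ring

/-- The origin of the denominator `k + 1`. The factor `2 * k` is kept on both sides because without
it the identity fails at `k = 0`, where the sum is `p + 1` instead of `p`. -/
theorem sum_range_raney (p k : ℕ) :
    2 * k * ∑ j ∈ Finset.range (p + 1), raney p j k =
      2 * k * p / (k + 1) * ((p + 1) * k).choose k := by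
  cases k with
  | zero => simp
  | succ k =>
    -- Hockey-stick summation: both binomials in `raney` telescope in `j`.
    have key : ∀ N, ∑ j ∈ Finset.range N, raney p j (k + 1) =
        ((p + 1) * (k + 1) + N).choose (k + 2) - ((p + 1) * (k + 1)).choose (k + 2) -
        (p + 1) * (((p + 1) * k + p + N).choose (k + 1) - ((p + 1) * k + p).choose (k + 1)) := by
      intro N
      induction N with
      | zero => simp
      | succ N ih =>
        rw [Finset.sum_range_succ, ih, raney, ← add_assoc, ← add_assoc,
          Nat.choose_succ_succ' _ (k + 1), Nat.choose_succ_succ' _ k]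
        push_cast
        ring
    rw [key]
    have h1 := Nat.add_one_mul_choose_eq ((p + 1) * (k + 1) + p) (k + 1)
    have h2 := Nat.choose_succ_right_eq ((p + 1) * (k + 1)) (k + 1)
    have h3 := Nat.add_one_mul_choose_eq ((p + 1) * k + p) k
    have h4 := Nat.choose_succ_succ' ((p + 1) * k + p) k
    have e1 : (p + 1) * (k + 1) + p + 1 = (p + 1) * (k + 1) + (p + 1) := by ring
    have e2 : (p + 1) * k + p + (p + 1) = (p + 1) * (k + 1) + p := by ring
    have e3 : (p + 1) * (k + 1) - (k + 1) = p * (k + 1) := by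
      rw [add_mul, one_mul, add_tsub_cancel_right]
    have e4 : (p + 1) * k + p + 1 = (p + 1) * (k + 1) := by ring
    rw [e1] at h1
    rw [e3] at h2
    rw [e4] at h3 h4
    rw [e2]
    push_cast
    generalize ((p + 1) * (k + 1)).choose (k + 1) = A at *
    generalize ((p + 1) * (k + 1)).choose (k + 2) = A' at *
    generalize ((p + 1) * (k + 1) + (p + 1)).choose (k + 2) = C at *
    generalize ((p + 1) * (k + 1) + p).choose (k + 1) = D at *
    generalize ((p + 1) * k + p).choose k = E at *
    generalize ((p + 1) * k + p).choose (k + 1) = E' at *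
    have h1' : ((p + 1 : ℚ) * (k + 1) + (p + 1)) * D = C * (k + 1 + 1) := by exact_mod_cast h1
    have h2' : (A' : ℚ) * (k + 1 + 1) = A * (p * (k + 1)) := by exact_mod_cast h2
    have h3' : ((p + 1 : ℚ) * (k + 1)) * E = A * (k + 1) := by exact_mod_cast h3
    have h4' : (A : ℚ) = E + E' := by exact_mod_cast h4
    have hk : (k + 1 : ℚ) ≠ 0 := by positivity
    have hk2 : (k + 1 + 1 : ℚ) ≠ 0 := by positivity
    have h5 : (p + 1 : ℚ) * E = A := mul_right_cancel₀ hk (by linear_combination h3')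
    have h6 : (C : ℚ) = (p + 1) * D := mul_right_cancel₀ hk2 (by linear_combination -h1')
    have h7 : (p + 1 : ℚ) * E' = p * A := by linear_combination (-(p + 1) : ℚ) * h4' - h5
    have h8 : (A' : ℚ) = p * A * (k + 1) / (k + 1 + 1) := by
      rw [eq_div_iff hk2]; linear_combination h2'
    have : (C : ℚ) - A' - (p + 1) * (D - E') = p * A - A' := by linear_combination h6 + h7
    rw [this, h8]
    field_simp
    ring

theorem raney_one (p j : ℕ) : raney p j 1 = j := by
  simp [raney]

end Numbers

/-! ### Paired and balanced cycles as products of reflections moving one point -/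

namespace AbsB

variable {n : ℕ}

/-- The paired cycle through `x` and the points of the list, written as a product of reflections
moving `x`. -/
def star (x : SignedPt n) : List (SignedPt n) → AbsB n
  | [] => 1
  | y :: l => star x l * refl x y

/-- The balanced cycle through `x` and the points of the list. -/
def bal (x : SignedPt n) (l : List (SignedPt n)) : AbsB n := refl x (-x) * star x l

/-- The points of the list have distinct absolute values. -/
def AbsDistinct (l : List (SignedPt n)) : Prop := l.Pairwise fun x y => x ≠ y ∧ x ≠ -y

theorem absDistinct_cons {x : SignedPt n} {l : List (SignedPt n)} :
    AbsDistinct (x :: l) ↔ (∀ y ∈ l, x ≠ y ∧ x ≠ -y) ∧ AbsDistinct l := List.pairwise_cons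

theorem AbsDistinct.sublist {l l' : List (SignedPt n)} (h : AbsDistinct l) (hs : l'.Sublist l) :
    AbsDistinct l' := List.Pairwise.sublist hs h

theorem AbsDistinct.perm {l l' : List (SignedPt n)} (h : AbsDistinct l) (hs : l.Perm l') :
    AbsDistinct l' :=
  List.Pairwise.perm h hs fun h => ⟨h.1.symm, fun e => h.2 (by rw [e, neg_neg])⟩

theorem AbsDistinct.map_neg {l : List (SignedPt n)} (h : AbsDistinct l) :
    AbsDistinct (l.map Neg.neg) := by
  rw [AbsDistinct, List.pairwise_map]
  refine List.Pairwise.imp (fun {a b} h => ?_) h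
  exact ⟨fun e => h.1 (neg_injective e), fun e => h.2 (neg_injective e)⟩

theorem AbsDistinct.nodup {l : List (SignedPt n)} (h : AbsDistinct l) : l.Nodup :=
  List.Pairwise.imp (fun h => h.1) h

theorem AbsDistinct.neg_notMem {l : List (SignedPt n)} (h : AbsDistinct l) {z : SignedPt n}
    (hz : z ∈ l) : -z ∉ l := by
  induction l with
  | nil => simp at hz
  | cons a l ih =>
    obtain ⟨h1, h2⟩ := absDistinct_cons.1 h
    rw [List.mem_cons, not_or]
    rcases List.mem_cons.1 hz with rfl | hz
    · exact ⟨(ne_neg z).symm, fun hz' => (h1 _ hz').2 (neg_neg z).symm⟩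
    · exact ⟨fun e => (h1 z hz).2 e.symm, ih h2 hz⟩

theorem oddInd_of_mem {l : List (SignedPt n)} (h : AbsDistinct l) {z : SignedPt n} (hz : z ∈ l) :
    oddInd l z = 1 := by
  simp [oddInd, hz, h.neg_notMem hz]

theorem oddInd_of_notMem {l : List (SignedPt n)} {z : SignedPt n} (hz : z ∉ l) :
    oddInd l z ≠ 1 := by
  simp only [oddInd, hz, if_false]
  split_ifs <;> norm_num

theorem conj_star (g : AbsB n) (x : SignedPt n) (l : List (SignedPt n)) :
    g * star x l * g⁻¹ = star (g • x) (l.map (g • ·)) := by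
  induction l with
  | nil => simp [star]
  | cons y l ih =>
    rw [star, List.map_cons, star, ← ih, ← conj_refl]
    group

theorem map_smul_eq {g : AbsB n} {l : List (SignedPt n)} (h : ∀ y ∈ l, g • y = y) :
    l.map (g • ·) = l := by
  conv_rhs => rw [← List.map_id l]
  exact List.map_congr_left h

theorem commute_star {g : AbsB n} {x : SignedPt n} {l : List (SignedPt n)}
    (h : ∀ y ∈ x :: l, g • y = y) : Commute g (star x l) := by
  have := conj_star g x l
  rw [h x List.mem_cons_self, map_smul_eq fun y hy => h y (List.mem_cons_of_mem _ hy),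
    mul_inv_eq_iff_eq_mul] at this
  exact this

theorem star_append (x : SignedPt n) (l l' : List (SignedPt n)) :
    star x (l ++ l') = star x l' * star x l := by
  induction l with
  | nil => simp [star]
  | cons y l ih => rw [List.cons_append, star, ih, star, mul_assoc]

theorem star_smul {x z : SignedPt n} {l : List (SignedPt n)}
    (h : ∀ y ∈ x :: l, z ≠ y ∧ z ≠ -y) : star x l • z = z := by
  induction l with
  | nil => rw [star, one_smul]
  | cons y l ih =>
    have hx := h x (by simp)
    have hy := h y (by simp)
    rw [star, mul_smul, refl_smul_of_ne hx.1 hy.1 hx.2 hy.2, ih]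
    intro t ht
    refine h t ?_
    rcases List.mem_cons.1 ht with rfl | ht
    · simp
    · simp [ht]

theorem neg_smul_of_ne {x z : SignedPt n} (h : z ≠ x ∧ z ≠ -x) : refl x (-x) • z = z :=
  refl_smul_of_ne h.1 h.2 h.2 (by rw [neg_neg]; exact h.1)

theorem bal_smul {x z : SignedPt n} {l : List (SignedPt n)}
    (h : ∀ y ∈ x :: l, z ≠ y ∧ z ≠ -y) : bal x l • z = z := by
  rw [bal, mul_smul, star_smul h, neg_smul_of_ne (h x List.mem_cons_self)]

theorem bal_nil (x : SignedPt n) : bal x [] = refl x (-x) := mul_one _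

theorem commute_bal {g : AbsB n} {x : SignedPt n} {l : List (SignedPt n)}
    (h : ∀ y ∈ x :: l, g • y = y) : Commute g (bal x l) := by
  have hx := h x List.mem_cons_self
  exact (commute_refl hx (smul_eq_of_neg hx)).mul_right (commute_star h)

theorem star_neg (x : SignedPt n) (l : List (SignedPt n)) :
    star (-x) l = star x (l.map Neg.neg) := by
  induction l with
  | nil => rfl
  | cons y l ih => rw [star, ih, List.map_cons, star, refl_neg_left]

theorem bal_neg (x : SignedPt n) (l : List (SignedPt n)) : bal (-x) (l.map Neg.neg) = bal x l := by
  have : (l.map Neg.neg).map Neg.neg = l := by simp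
  rw [bal, star_neg, this, neg_neg, refl_comm, bal]

/-- Conjugation by `[x]` changes the sign of the other points. -/
theorem refl_neg_mul_star {x : SignedPt n} {l : List (SignedPt n)} (h : AbsDistinct (x :: l)) :
    refl x (-x) * star x l = star x (l.map Neg.neg) * refl x (-x) := by
  have := conj_star (refl x (-x)) x l
  rw [refl_smul_left, map_smul_eq, star_neg, mul_inv_eq_iff_eq_mul] at this
  · exact this
  · intro y hy
    have h1 := (absDistinct_cons.1 h).1 y hy
    exact neg_smul_of_ne ⟨h1.1.symm, fun e => h1.2 (by rw [e, neg_neg])⟩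

theorem refl_mul_star_mul_refl {x y : SignedPt n} {l : List (SignedPt n)}
    (h : AbsDistinct (x :: y :: l)) : refl x y * star x l * refl x y = star y l := by
  have := conj_star (refl x y) x l
  rw [refl_smul_left, map_smul_eq, refl_inv] at this
  · exact this
  · intro z hz
    rw [absDistinct_cons, absDistinct_cons] at h
    have hx := h.1 z (List.mem_cons_of_mem _ hz)
    have hy := h.2.1 z hz
    exact refl_smul_of_ne hx.1.symm hy.1.symm (fun e => hx.2 (by rw [e, neg_neg]))
      (fun e => hy.2 (by rw [e, neg_neg]))

/-- The half-turn of a coordinate plane is a product of two orthogonal reflections in two ways. This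
is what makes splitting and merging of balanced cycles work. -/
theorem refl_mul_refl_neg (x y : SignedPt n) (h : x ≠ y ∧ x ≠ -y) :
    refl x y * refl x (-y) = refl x (-x) * refl y (-y) := by
  have h1 : refl x y • (-y) = -x := by rw [smul_neg_pt, refl_smul_right]
  have h2 : refl x (-x) • y = y :=
    neg_smul_of_ne ⟨h.1.symm, fun e => h.2 (by rw [e, neg_neg])⟩
  have h3 : refl x (-x) * refl x y = refl x (-y) * refl x (-x) := by
    rw [mul_refl, refl_smul_left, h2, refl_neg_left]
  have h4 : refl x y * refl x (-x) = refl y (-y) * refl x y := by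
    rw [mul_refl, refl_smul_left, smul_neg_pt, refl_smul_left]
  have h5 : refl x (-x) * refl y (-y) = refl y (-y) * refl x (-x) :=
    commute_refl h2 (smul_eq_of_neg h2)
  calc refl x y * refl x (-y) = refl x y * (refl x (-y) * refl x (-x)) * refl x (-x) := by
        simp [mul_assoc]
    _ = refl x y * refl x (-x) * refl x y * refl x (-x) := by rw [← h3]; simp only [mul_assoc]
    _ = refl y (-y) * refl x (-x) := by rw [h4]; simp only [mul_assoc, refl_mul_self_assoc]
    _ = _ := h5.symm

/-- Conjugation by `refl x y` moves the base point of the first part from `x` to `y`; the two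
resulting cycles are disjoint and commute. -/
theorem star_split {x y : SignedPt n} {l l' : List (SignedPt n)}
    (h : AbsDistinct (x :: y :: (l ++ l'))) :
    star x (l ++ y :: l') * refl x y = star y l * star x l' := by
  have hs : AbsDistinct (x :: y :: l) :=
    h.sublist (((List.sublist_append_left l l').cons_cons y).cons_cons x)
  have e : star x (l ++ y :: l') * refl x y = star x l' * star y l := by
    rw [star_append, star, ← refl_mul_star_mul_refl hs]
    simp only [mul_assoc]
  rw [e]
  refine (commute_star fun z hz => star_smul fun t ht => ?_).eq.symm
  have hp : AbsDistinct ((y :: l) ++ (x :: l')) := by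
    refine h.perm ?_
    rw [List.cons_append]
    exact (List.Perm.swap y x _).trans (List.perm_middle.symm.cons y)
  have := (List.pairwise_append.1 hp).2.2 t ht z hz
  exact ⟨this.1.symm, fun e => this.2 (by rw [e, neg_neg])⟩

end AbsB

/-! ### Sums indexed by the points of a cycle -/

theorem sum_filter_eq_sum_list {α : Type*} [Fintype α] [DecidableEq α] (P : α → Prop)
    [DecidablePred P] {L : List α} (hL : L.Nodup) (h : ∀ y, P y ↔ y ∈ L) (f : α → ℚ) :
    ∑ y with P y, f y = (L.map f).sum := by
  rw [← List.sum_toFinset f hL]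
  refine Finset.sum_congr ?_ fun _ _ => rfl
  ext y
  simp [h]

theorem sum_list_split {α : Type*} (l : List α) (f : α → ℚ) (H : ℕ → ℕ → ℚ)
    (h : ∀ l₁ y l₂, l = l₁ ++ y :: l₂ → f y = H l₁.length l₂.length) :
    (l.map f).sum = ∑ i ∈ Finset.range l.length, H i (l.length - 1 - i) := by
  induction l generalizing H with
  | nil => simp
  | cons a l ih =>
    rw [List.map_cons, List.sum_cons, List.length_cons, Finset.sum_range_succ',
      ih (fun i => H (i + 1)), h [] a l rfl, add_comm]
    · congr 1
      refine Finset.sum_congr rfl fun i _ => ?_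
      congr 1
      omega
    · rintro l₁ y l₂ rfl
      exact h (a :: l₁) y l₂ rfl

theorem sum_list_const {α : Type*} (l : List α) (f : α → ℚ) (c : ℚ) (h : ∀ y ∈ l, f y = c) :
    (l.map f).sum = l.length * c := by
  rw [List.map_congr_left h, List.map_const', List.sum_replicate, nsmul_eq_mul]

/-! ### Factorization counts of paired cycles -/

namespace AbsB

variable {n : ℕ}

theorem star_smul_head {x y : SignedPt n} {l : List (SignedPt n)}
    (h : AbsDistinct (x :: y :: l)) : star x l • y = y := by
  rw [absDistinct_cons, absDistinct_cons] at h
  refine star_smul fun t ht => ?_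
  rcases List.mem_cons.1 ht with rfl | ht
  · have := h.1 y List.mem_cons_self
    exact ⟨this.1.symm, fun e => this.2 (by rw [e, neg_neg])⟩
  · exact h.2.1 t ht

theorem len_mul_star {g : AbsB n} {x : SignedPt n} {l : List (SignedPt n)}
    (hg : ∀ y ∈ l, g • y = y) (h : AbsDistinct (x :: l)) :
    len (g * star x l) = len g + l.length := by
  induction l with
  | nil => simp [star]
  | cons y l ih =>
    have h' : AbsDistinct (x :: l) := h.sublist ((List.sublist_cons_self y l).cons_cons x)
    rw [star, ← mul_assoc, len_mul_refl_of_smul, ih (fun z hz => hg z (List.mem_cons_of_mem _ hz)) h',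
      List.length_cons, add_assoc]
    · rw [mul_smul, star_smul_head h, hg y List.mem_cons_self]
    · exact ((absDistinct_cons.1 h).1 y List.mem_cons_self).1

theorem len_mul_bal {g : AbsB n} {x : SignedPt n} {l : List (SignedPt n)}
    (hg : ∀ y ∈ x :: l, g • y = y) (h : AbsDistinct (x :: l)) :
    len (g * bal x l) = len g + l.length + 1 := by
  have hx := hg x List.mem_cons_self
  rw [bal, ← mul_assoc, len_mul_star _ h, len_mul_refl_of_smul (smul_eq_of_neg hx) (ne_neg x)]
  · ring
  · intro y hy
    have h1 := (absDistinct_cons.1 h).1 y hy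
    rw [mul_smul, neg_smul_of_ne ⟨h1.1.symm, fun e => h1.2 (by rw [e, neg_neg])⟩,
      hg y (List.mem_cons_of_mem _ hy)]

theorem oddInd_mem_invts_star {x : SignedPt n} {l L : List (SignedPt n)} (hL : AbsDistinct L)
    (h : ∀ y ∈ x :: l, y ∈ L) : oddInd L ∈ invts (star x l) := by
  induction l with
  | nil => exact mem_invts_one.2 (oddInd_neg L)
  | cons y l ih =>
    refine mem_invts_mul (ih fun z hz => h z ?_) (mem_invts_refl.2 ⟨oddInd_neg L, ?_⟩)
    · rcases List.mem_cons.1 hz with rfl | hz <;> simp [*]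
    · rw [oddInd_of_mem hL (h x (by simp)), oddInd_of_mem hL (h y (by simp))]

/-- The points of a list `x :: (l₁ ++ y :: l₂)` in the order `y :: l₁` followed by `x :: l₂`. -/
theorem AbsDistinct.split {x y : SignedPt n} {l₁ l₂ : List (SignedPt n)}
    (h : AbsDistinct (x :: (l₁ ++ y :: l₂))) : AbsDistinct ((y :: l₁) ++ (x :: l₂)) := by
  refine h.perm ?_
  rw [List.cons_append]
  exact ((List.perm_middle.cons x).trans (List.Perm.swap y x _)).trans
    (List.perm_middle.symm.cons y)

theorem absDistinct_append {l₁ l₂ : List (SignedPt n)} :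
    AbsDistinct (l₁ ++ l₂) ↔ AbsDistinct l₁ ∧ AbsDistinct l₂ ∧
      ∀ a ∈ l₁, ∀ b ∈ l₂, a ≠ b ∧ a ≠ -b := List.pairwise_append

theorem ne_and_ne_neg_symm {a b : SignedPt n} (h : a ≠ b ∧ a ≠ -b) : b ≠ a ∧ b ≠ -a :=
  ⟨h.1.symm, fun e => h.2 (by rw [e, neg_neg])⟩

/-- A factorization count is multiplicative with respect to disjoint paired cycles. -/
theorem starCount_mul_star (p : ℕ) {l : List (SignedPt n)} {c : AbsB n} {x : SignedPt n}
    (hc : ∀ z ∈ x :: l, c • z = z) (hd : AbsDistinct (x :: l)) (j : ℕ) :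
    starCount (p + 1) x j (c * star x l) = facCount (p + 1) c * raney p j l.length := by
  induction hs : l.length using Nat.strong_induction_on generalizing l c x j with
  | _ s ih =>
  induction j with
  | zero =>
    -- Without star steps the element must fix `x`, so only a one-point cycle contributes: `T^0 =
    -- 1`.
    rw [starCount_zero]
    cases l with
    | nil =>
      subst hs
      rw [star, mul_one, restr_of_smul _ (hc x List.mem_cons_self), List.length_nil,
        raney_zero_right, mul_one]
    | cons y l =>
      rw [← hs, List.length_cons, raney_zero_succ, mul_zero, restr_of_ne]
      rw [mul_smul, star, mul_smul, refl_smul_left, star_smul_head hd, hc y (by simp)]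
      exact ((absDistinct_cons.1 hd).1 y List.mem_cons_self).1.symm
  | succ j ihj =>
    -- The cycle through `y :: l₁` is cut off and fixes `x`, so it joins the cofactor and receives
    -- its full count, the exponent `p + 1`. The cycle keeping `x` has `j` star steps left.
    have hdown : ∀ l₁ y l₂, l = l₁ ++ y :: l₂ →
        (len (c * star x l * refl x y) + 1 = len (c * star x l) ∧
        starCount (p + 1) x j (c * star x l * refl x y) =
          facCount (p + 1) c * (raney p (p + 1) l₁.length * raney p j l₂.length)) := by
      rintro l₁ y l₂ rfl
      have hd' := hd.split
      obtain ⟨hd1, hd2, hd3⟩ := absDistinct_append.1 hd'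
      have hperm : AbsDistinct (x :: y :: (l₁ ++ l₂)) := hd.perm (List.perm_middle.cons x)
      have hc1 : ∀ z ∈ y :: l₁, c • z = z := fun z hz => hc z (by
        simp only [List.mem_cons, List.mem_append] at hz ⊢; tauto)
      have hc2 : ∀ z ∈ x :: l₂, (c * star y l₁) • z = z := fun z hz => by
        rw [mul_smul, star_smul fun t ht => ne_and_ne_neg_symm (hd3 t ht z hz)]
        exact hc z (by simp only [List.mem_cons, List.mem_append] at hz ⊢; tauto)
      have e : c * star x (l₁ ++ y :: l₂) * refl x y = c * star y l₁ * star x l₂ := by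
        rw [mul_assoc, star_split hperm, mul_assoc]
      have hlen : (l₁ ++ y :: l₂).length = l₁.length + l₂.length + 1 := by simp; ring
      rw [e]
      constructor
      · rw [len_mul_star (fun z hz => hc2 z (List.mem_cons_of_mem _ hz)) hd2,
          len_mul_star (fun z hz => hc1 z (List.mem_cons_of_mem _ hz)) hd1,
          len_mul_star (fun z hz => hc z (List.mem_cons_of_mem _ hz)) hd, hlen]
        ring
      · rw [ih l₂.length (by omega) hc2 hd2 j rfl, ← starCount_self (p + 1) y,
          ih l₁.length (by omega) hc1 hd1 (p + 1) rfl, mul_assoc, starCount_self]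
    rw [starCount_succ, ihj, raney_rec, mul_add, Finset.mul_sum]
    congr 1
    classical
    rw [sum_filter_eq_sum_list _ (L := l) (absDistinct_cons.1 hd).2.nodup,
      sum_list_split l _ (fun a b => facCount (p + 1) c * (raney p (p + 1) a * raney p j b))
        fun l₁ y l₂ h => (hdown l₁ y l₂ h).2, hs]
    intro y
    constructor
    -- The odd indicator of the cycle is invariant and separates `x` from every point off the cycle,
    -- including the negatives of its points.
    · rintro ⟨hy, hl⟩
      by_contra hyl
      have hmem : oddInd (x :: l) ∈ invts (c * star x l) :=
        mem_invts_mul (oddInd_mem_invts hc) (oddInd_mem_invts_star hd fun _ h => h)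
      have := len_mul_refl_of_mem hmem (x := x) (y := y) (by
        rw [oddInd_of_mem hd List.mem_cons_self]
        exact (oddInd_of_notMem (by simp [hy, hyl])).symm)
      omega
    · intro hy
      obtain ⟨l₁, l₂, h⟩ := List.append_of_mem hy
      exact ⟨((absDistinct_cons.1 hd).1 y hy).1.symm, (hdown _ _ _ h).1⟩

theorem facCount_mul_star (p : ℕ) {l : List (SignedPt n)} {c : AbsB n} {x : SignedPt n}
    (hc : ∀ z ∈ x :: l, c • z = z) (hd : AbsDistinct (x :: l)) :
    facCount (p + 1) (c * star x l) = facCount (p + 1) c * raney p (p + 1) l.length := by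
  rw [← starCount_self (p + 1) x, starCount_mul_star p hc hd, starCount_self]

theorem starCount_of_smul (p : ℕ) {c : AbsB n} {x : SignedPt n} (hc : c • x = x) (j : ℕ) :
    starCount (p + 1) x j c = facCount (p + 1) c := by
  have := starCount_mul_star p (l := []) (c := c) (x := x) (by simpa using hc)
    (List.pairwise_singleton _ _) j
  simpa [star, raney_zero_right] using this

end AbsB

/-! ### Factorization counts of balanced cycles -/

namespace AbsB

variable {n : ℕ}

/-- The element has no balanced cycles. -/
def NoBalanced (c : AbsB n) : Prop := ∀ z, ∃ f ∈ invts c, f z ≠ 0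

theorem noBalanced_one : NoBalanced (1 : AbsB n) := fun z =>
  ⟨oddInd [z], mem_invts_one.2 (oddInd_neg _), by rw [oddInd_singleton_self]; exact one_ne_zero⟩

/-- The function equal to `f` except that it vanishes on the points of `L` and their negatives. -/
def cut (L : List (SignedPt n)) (f : SignedPt n → ℚ) (z : SignedPt n) : ℚ :=
  if z ∈ L ∨ -z ∈ L then 0 else f z

theorem cut_neg {L : List (SignedPt n)} {f : SignedPt n → ℚ} (hf : ∀ z, f (-z) = -f z)
    (z : SignedPt n) : cut L f (-z) = -cut L f z := by
  simp only [cut, neg_neg, hf, or_comm (a := -z ∈ L)]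
  split_ifs <;> simp

theorem cut_mem_invts {L : List (SignedPt n)} {f : SignedPt n → ℚ} {c : AbsB n} (hf : f ∈ invts c)
    (hc : ∀ z ∈ L, c • z = z) : cut L f ∈ invts c :=
  ⟨cut_neg hf.1, fun z => by simp only [cut, ← smul_neg_pt, smul_mem_iff hc, hf.2]⟩

theorem cut_mem_invts_refl {L : List (SignedPt n)} {f : SignedPt n → ℚ} {x y : SignedPt n}
    (hf : ∀ z, f (-z) = -f z) (hx : x ∈ L) (hy : y ∈ L ∨ -y ∈ L) : cut L f ∈ invts (refl x y) :=
  mem_invts_refl.2 ⟨cut_neg hf, by simp [cut, hx, hy]⟩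

theorem cut_mem_invts_star {L : List (SignedPt n)} {f : SignedPt n → ℚ} {x : SignedPt n}
    {l : List (SignedPt n)} (hf : ∀ z, f (-z) = -f z) (h : ∀ z ∈ x :: l, z ∈ L) :
    cut L f ∈ invts (star x l) := by
  induction l with
  | nil => exact mem_invts_one.2 (cut_neg hf)
  | cons y l ih =>
    refine mem_invts_mul (ih fun z hz => h z ?_)
      (cut_mem_invts_refl hf (h x (by simp)) (Or.inl (h y (by simp))))
    rcases List.mem_cons.1 hz with rfl | hz <;> simp [*]

theorem NoBalanced.mul_star {c : AbsB n} {x : SignedPt n} {l : List (SignedPt n)}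
    (h : NoBalanced c) (hc : ∀ z ∈ x :: l, c • z = z) (hd : AbsDistinct (x :: l)) :
    NoBalanced (c * star x l) := by
  intro z
  have hind : oddInd (x :: l) ∈ invts (c * star x l) :=
    mem_invts_mul (oddInd_mem_invts hc) (oddInd_mem_invts_star hd fun _ h => h)
  by_cases h1 : z ∈ x :: l
  · exact ⟨_, hind, by rw [oddInd_of_mem hd h1]; exact one_ne_zero⟩
  by_cases h2 : -z ∈ x :: l
  · refine ⟨_, hind, ?_⟩
    have := oddInd_neg (x :: l) (-z)
    rw [neg_neg, oddInd_of_mem hd h2] at this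
    rw [this]
    norm_num
  obtain ⟨f, hf, hz⟩ := h z
  refine ⟨cut (x :: l) f, mem_invts_mul (cut_mem_invts hf hc)
    (cut_mem_invts_star hf.1 fun _ h => h), ?_⟩
  rw [cut, if_neg (by tauto)]
  exact hz

/-- The split happens inside the `star` part; the detached paired cycle is disjoint from `±x` and
hence commutes past `[x]`. -/
theorem bal_mul_refl {x y : SignedPt n} {l₁ l₂ : List (SignedPt n)}
    (h : AbsDistinct (x :: (l₁ ++ y :: l₂))) :
    bal x (l₁ ++ y :: l₂) * refl x y = star y l₁ * bal x l₂ := by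
  obtain ⟨h1, h2, h3⟩ := absDistinct_append.1 h.split
  rw [bal, mul_assoc, star_split (h.perm (List.perm_middle.cons x)), bal, ← mul_assoc, ← mul_assoc]
  congr 1
  have e : ∀ z ∈ y :: l₁, refl x (-x) • z = z := fun z hz =>
    neg_smul_of_ne (h3 z hz x List.mem_cons_self)
  exact (commute_star e).eq

theorem refl_neg_mul_star_mul_refl_neg {x y : SignedPt n} {l : List (SignedPt n)}
    (h : AbsDistinct (x :: y :: l)) :
    refl x (-x) * (refl x y * star x l) * refl x (-y) = bal y (l.map Neg.neg) := by
  have hxy := (absDistinct_cons.1 h).1 y List.mem_cons_self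
  have h2 := (absDistinct_cons.1 h).2
  have e1 : refl x y * star x l = star y l * refl x y := by
    rw [← refl_mul_star_mul_refl h]; simp [mul_assoc]
  have hfix : ∀ z ∈ y :: l, refl x (-x) • z = z := fun z hz =>
    neg_smul_of_ne (ne_and_ne_neg_symm ((absDistinct_cons.1 h).1 z hz))
  have hc := (commute_star hfix).eq
  have e3 : (l.map Neg.neg).map Neg.neg = l := by simp
  have hd' : AbsDistinct (y :: l.map Neg.neg) := by
    refine absDistinct_cons.2 ⟨fun z hz => ?_, (absDistinct_cons.1 h2).2.map_neg⟩
    obtain ⟨t, ht, rfl⟩ := List.mem_map.1 hz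
    have := (absDistinct_cons.1 h2).1 t ht
    exact ⟨this.2, by rw [neg_neg]; exact this.1⟩
  rw [bal, refl_neg_mul_star hd', e3, e1]
  calc refl x (-x) * (star y l * refl x y) * refl x (-y)
      = refl x (-x) * star y l * (refl x y * refl x (-y)) := by simp only [mul_assoc]
    _ = star y l * refl x (-x) * (refl x (-x) * refl y (-y)) := by
        rw [refl_mul_refl_neg x y hxy, hc]
    _ = _ := by simp [mul_assoc]

theorem AbsDistinct.cons_map_neg {x : SignedPt n} {l : List (SignedPt n)}
    (h : AbsDistinct (x :: l)) : AbsDistinct (x :: l.map Neg.neg) := by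
  refine absDistinct_cons.2 ⟨fun z hz => ?_, (absDistinct_cons.1 h).2.map_neg⟩
  obtain ⟨t, ht, rfl⟩ := List.mem_map.1 hz
  have := (absDistinct_cons.1 h).1 t ht
  exact ⟨this.2, by rw [neg_neg]; exact this.1⟩

/-- With the opposite sign the roles are exchanged: `x` stays on the paired cycle and `y` carries
the balanced one. -/
theorem bal_mul_refl_neg {x y : SignedPt n} {l₁ l₂ : List (SignedPt n)}
    (h : AbsDistinct (x :: (l₁ ++ y :: l₂))) :
    bal x (l₁ ++ y :: l₂) * refl x (-y) =
      star x (l₂.map Neg.neg) * bal y (l₁.map Neg.neg) := by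
  obtain ⟨h1, h2, h3⟩ := absDistinct_append.1 h.split
  have hd1 : AbsDistinct (x :: y :: l₁) :=
    (h.perm (List.perm_middle.cons x)).sublist
      (((List.sublist_append_left l₁ l₂).cons_cons y).cons_cons x)
  rw [bal, star_append, star, ← refl_neg_mul_star_mul_refl_neg hd1,
    ← mul_assoc _ (refl x (-x) * _), ← mul_assoc _ (refl x (-x)), ← refl_neg_mul_star h2]
  simp only [mul_assoc]

theorem bal_mul_refl_neg_self {x : SignedPt n} {l : List (SignedPt n)}
    (h : AbsDistinct (x :: l)) : bal x l * refl x (-x) = star x (l.map Neg.neg) := by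
  rw [bal, refl_neg_mul_star h, mul_assoc, refl_mul_self, mul_one]

theorem smul_of_mem_map_neg {c : AbsB n} {l : List (SignedPt n)} (h : ∀ z ∈ l, c • z = z) :
    ∀ z ∈ l.map Neg.neg, c • z = z := by
  intro z hz
  obtain ⟨t, ht, rfl⟩ := List.mem_map.1 hz
  exact smul_eq_of_neg (h t ht)

theorem AbsDistinct.nodup_append_map_neg {l : List (SignedPt n)} (h : AbsDistinct l) :
    (l ++ l.map Neg.neg).Nodup := by
  refine List.nodup_append.2 ⟨h.nodup, h.map_neg.nodup, ?_⟩
  rintro a ha b hb rfl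
  obtain ⟨t, ht, rfl⟩ := List.mem_map.1 hb
  exact h.neg_notMem ht ha

theorem AbsDistinct.nodup_signed {x : SignedPt n} {l : List (SignedPt n)}
    (h : AbsDistinct (x :: l)) : (-x :: (l ++ l.map Neg.neg)).Nodup := by
  obtain ⟨hxl, hn⟩ := absDistinct_cons.1 h
  refine List.nodup_cons.2 ⟨fun h' => ?_, hn.nodup_append_map_neg⟩
  rcases List.mem_append.1 h' with h' | h'
  · exact h.neg_notMem List.mem_cons_self (List.mem_cons_of_mem _ h')
  · obtain ⟨t, ht, e⟩ := List.mem_map.1 h'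
    exact (hxl t ht).1 (neg_injective e).symm

/-- Factorization counts of a product of paired cycles and a balanced cycle. -/
theorem starCount_mul_bal (p : ℕ) {l : List (SignedPt n)} {c : AbsB n} {x : SignedPt n}
    (hb : NoBalanced c) (hc : ∀ z ∈ x :: l, c • z = z) (hd : AbsDistinct (x :: l)) (j : ℕ) :
    starCount (p + 1) x j (c * bal x l) = facCount (p + 1) c * balNum p j l.length := by
  induction hs : l.length using Nat.strong_induction_on generalizing l c x j with
  | _ s ih =>
  have hx := hc x List.mem_cons_self
  have hxl := (absDistinct_cons.1 hd).1
  induction j with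
  | zero =>
    -- A balanced cycle through `x` always moves `x`.
    rw [starCount_zero, restr_of_ne, balNum, Nat.cast_zero, zero_mul, mul_zero]
    rw [mul_smul]
    cases l with
    | nil =>
      rw [bal_nil, refl_smul_left, smul_eq_of_neg hx]
      exact (ne_neg x).symm
    | cons y l =>
      have hy := hxl y List.mem_cons_self
      rw [bal, star, mul_smul, mul_smul, refl_smul_left, star_smul_head hd,
        neg_smul_of_ne (ne_and_ne_neg_symm hy), hc y (by simp)]
      exact hy.1.symm
  | succ j ihj =>
    have hlen := len_mul_bal hc hd
    -- Peeling `refl x y` leaves `x` on the balanced part, peeling `refl x (-y)` leaves it on the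
    -- paired part. The part without `x` gets its full count: `raney p (p + 1)` if paired, the
    -- binomial of `balNum_self` if balanced.
    have hdown : ∀ l₁ y l₂, l = l₁ ++ y :: l₂ →
        (len (c * bal x l * refl x y) + 1 = len (c * bal x l) ∧
        starCount (p + 1) x j (c * bal x l * refl x y) =
          facCount (p + 1) c * (raney p (p + 1) l₁.length * balNum p j l₂.length)) ∧
        (len (c * bal x l * refl x (-y)) + 1 = len (c * bal x l) ∧
        starCount (p + 1) x j (c * bal x l * refl x (-y)) =
          facCount (p + 1) c * (((p + 1) * (l₁.length + 1)).choose (l₁.length + 1) *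
            raney p j l₂.length)) := by
      rintro l₁ y l₂ rfl
      obtain ⟨hd1, hd2, hd3⟩ := absDistinct_append.1 hd.split
      have hc1 : ∀ z ∈ y :: l₁, c • z = z := fun z hz => hc z (by
        simp only [List.mem_cons, List.mem_append] at hz ⊢; tauto)
      have hc2 : ∀ z ∈ x :: l₂, c • z = z := fun z hz => hc z (by
        simp only [List.mem_cons, List.mem_append] at hz ⊢; tauto)
      have hc1' : ∀ z ∈ y :: l₁.map Neg.neg, c • z = z := fun z hz => by
        rcases List.mem_cons.1 hz with rfl | hz
        · exact hc1 z List.mem_cons_self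
        · exact smul_of_mem_map_neg (fun t ht => hc1 t (List.mem_cons_of_mem _ ht)) z hz
      have hl : (l₁ ++ y :: l₂).length = l₁.length + l₂.length + 1 := by simp; ring
      refine ⟨?_, ?_⟩
      · have hf : ∀ z ∈ x :: l₂, (c * star y l₁) • z = z := fun z hz => by
          rw [mul_smul, star_smul fun t ht => ne_and_ne_neg_symm (hd3 t ht z hz), hc2 z hz]
        rw [hlen, hl, mul_assoc, bal_mul_refl hd, ← mul_assoc]
        constructor
        · rw [len_mul_bal hf hd2, len_mul_star (fun z hz => hc1 z (List.mem_cons_of_mem _ hz)) hd1]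
          ring
        · rw [ih l₂.length (by omega) (hb.mul_star hc1 hd1) hf hd2 j rfl,
            facCount_mul_star p hc1 hd1, mul_assoc]
      · have hb1 : ∀ z ∈ x :: l₂, bal y (l₁.map Neg.neg) • z = z := fun z hz => by
          refine bal_smul fun t ht => ?_
          rcases List.mem_cons.1 ht with rfl | ht
          · exact ne_and_ne_neg_symm (hd3 t List.mem_cons_self z hz)
          · obtain ⟨u, hu, rfl⟩ := List.mem_map.1 ht
            have := ne_and_ne_neg_symm (hd3 u (List.mem_cons_of_mem _ hu) z hz)
            exact ⟨this.2, by rw [neg_neg]; exact this.1⟩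
        have hf : ∀ z ∈ x :: l₂.map Neg.neg, (c * bal y (l₁.map Neg.neg)) • z = z := fun z hz => by
          rw [mul_smul]
          rcases List.mem_cons.1 hz with rfl | hz
          · rw [hb1 z List.mem_cons_self, hx]
          · have h1 := smul_of_mem_map_neg (fun t ht => hb1 t (List.mem_cons_of_mem _ ht)) z hz
            rw [h1]
            exact smul_of_mem_map_neg (fun t ht => hc2 t (List.mem_cons_of_mem _ ht)) z hz
        have hcomm : star x (l₂.map Neg.neg) * bal y (l₁.map Neg.neg) =
            bal y (l₁.map Neg.neg) * star x (l₂.map Neg.neg) := by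
          refine (commute_star fun z hz => ?_).eq.symm
          rcases List.mem_cons.1 hz with rfl | hz
          · exact hb1 z List.mem_cons_self
          · exact smul_of_mem_map_neg (fun t ht => hb1 t (List.mem_cons_of_mem _ ht)) z hz
        rw [hlen, hl, mul_assoc, bal_mul_refl_neg hd, hcomm, ← mul_assoc]
        constructor
        · rw [len_mul_star (fun z hz => hf z (List.mem_cons_of_mem _ hz)) hd2.cons_map_neg,
            len_mul_bal hc1' hd1.cons_map_neg, List.length_map, List.length_map]
          ring
        · rw [starCount_mul_star p hf hd2.cons_map_neg, ← starCount_self (p + 1) y,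
            ih _ (by omega) hb hc1' hd1.cons_map_neg (p + 1) (List.length_map _), balNum_self,
            List.length_map, mul_assoc, starCount_self]
    have hself : len (c * bal x l * refl x (-x)) + 1 = len (c * bal x l) ∧
        starCount (p + 1) x j (c * bal x l * refl x (-x)) =
          facCount (p + 1) c * raney p j l.length := by
      have hf : ∀ z ∈ l.map Neg.neg, c • z = z :=
        smul_of_mem_map_neg fun t ht => hc t (List.mem_cons_of_mem _ ht)
      rw [hlen, mul_assoc, bal_mul_refl_neg_self hd]
      constructor
      · rw [len_mul_star hf hd.cons_map_neg, List.length_map]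
      · rw [starCount_mul_star p _ hd.cons_map_neg, List.length_map]
        exact List.forall_mem_cons.2 ⟨hx, hf⟩
    rw [starCount_succ, ihj, balNum_rec, mul_add, mul_add, add_assoc, Finset.mul_sum]
    congr 1
    classical
    rw [sum_filter_eq_sum_list _ (L := -x :: (l ++ l.map Neg.neg)), List.map_cons, List.sum_cons,
      List.map_append, List.sum_append, hself.2, List.map_map, hs,
      sum_list_split l _ (fun a b => facCount (p + 1) c * (raney p (p + 1) a * balNum p j b))
        fun l₁ y l₂ h => (hdown l₁ y l₂ h).1.2,
      sum_list_split l ((fun y => starCount (p + 1) x j (c * bal x l * refl x y)) ∘ Neg.neg)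
        (fun a b => facCount (p + 1) c * (((p + 1) * (a + 1)).choose (a + 1) *
            raney p j b))
        fun l₁ y l₂ h => (hdown l₁ y l₂ h).2.2, hs, ← Finset.sum_add_distrib]
    · simp only [mul_add]
    · exact hd.nodup_signed
    · intro y
      constructor
      · rintro ⟨hy, hl⟩
        by_contra hyl
        -- As `c` has no balanced cycle, some invariant of `c` is nonzero at `y`. Cut to zero on the
        -- balanced cycle it stays invariant and separates `x` from `y`. A second balanced cycle
        -- through `y` would instead allow a merge.
        obtain ⟨f, hf, hfy⟩ := hb y
        have hmem : cut (x :: l) f ∈ invts (c * bal x l) :=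
          mem_invts_mul (cut_mem_invts hf hc) (mem_invts_mul
            (cut_mem_invts_refl hf.1 (by simp) (by simp)) (cut_mem_invts_star hf.1 fun _ h => h))
        have := len_mul_refl_of_mem hmem (x := x) (y := y) (by
          rw [cut, cut, if_pos (by simp), if_neg]
          · exact hfy.symm
          · rintro (h | h)
            · simp at h hyl
              tauto
            · apply hyl
              rcases List.mem_cons.1 h with h | h
              · rw [← h, neg_neg]; simp
              · refine List.mem_cons_of_mem _ (List.mem_append_right _ ?_)
                exact List.mem_map.2 ⟨-y, h, neg_neg y⟩)
        omega
      · intro hy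
        rcases List.mem_cons.1 hy with rfl | hy
        · exact ⟨(ne_neg x).symm, hself.1⟩
        rcases List.mem_append.1 hy with hy | hy
        · obtain ⟨l₁, l₂, h⟩ := List.append_of_mem hy
          exact ⟨(hxl y hy).1.symm, (hdown _ _ _ h).1.1⟩
        · obtain ⟨t, ht, rfl⟩ := List.mem_map.1 hy
          obtain ⟨l₁, l₂, h⟩ := List.append_of_mem ht
          exact ⟨(hxl t ht).2.symm, (hdown _ _ _ h).2.1⟩

theorem facCount_mul_bal (p : ℕ) {l : List (SignedPt n)} {c : AbsB n} {x : SignedPt n}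
    (hb : NoBalanced c) (hc : ∀ z ∈ x :: l, c • z = z) (hd : AbsDistinct (x :: l)) :
    facCount (p + 1) (c * bal x l) =
      facCount (p + 1) c * ((p + 1) * (l.length + 1)).choose (l.length + 1) := by
  rw [← starCount_self (p + 1) x, starCount_mul_bal p hb hc hd, starCount_self, balNum_self]

end AbsB

/-! ### The closed form and its recursion in `r` -/

/-- The zeta polynomial of `𝓛_r`, evaluated at `p + 1`. -/
def singleNum (p : ℕ) : ℕ → ℚ
  | 0 => 1
  | 1 => p + 1
  | r + 2 => (p + 1) * singleNum p (r + 1) + (r + 1) * ((p + 1) * p) * singleNum p r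

theorem singleNum_succ (p r : ℕ) : singleNum p (r + 1) =
    (p + 1) * singleNum p r + r * ((p + 1) * p) * singleNum p (r - 1) := by
  cases r with
  | zero => simp [singleNum]
  | succ r => rw [singleNum]; push_cast; rfl

/-- The zeta polynomial of `L(k, r)`, evaluated at `p + 1`. -/
def hookNum (p k r : ℕ) : ℚ :=
  ((p + 1) * k).choose k * (2 * r * k / (k + 1) * p * singleNum p (r - 1) + singleNum p r)

theorem hookNum_zero_left (p r : ℕ) : hookNum p 0 r = singleNum p r := by simp [hookNum]

theorem hookNum_zero_right (p k : ℕ) : hookNum p k 0 = ((p + 1) * k).choose k := by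
  simp [hookNum, singleNum]

/-- With `s_r = singleNum p r` and `κ = 2kp/(k+1)`, the closed form is the binomial times `κ r
s_(r-1) + s_r`. Both summands satisfy the recursion of `s`, except that the factor `r` grows by one;
this leaves the extra term `κ s_r`. -/
theorem hookNum_succ (p k r : ℕ) : hookNum p k (r + 1) =
    (p + 1) * hookNum p k r + r * ((p + 1) * p) * hookNum p k (r - 1) +
      2 * k * p / (k + 1) * ((p + 1) * k).choose k * singleNum p r := by
  have h := singleNum_succ p r
  cases r with
  | zero => simp [hookNum, singleNum] at *; ring
  | succ r =>
    have h' := singleNum_succ p r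
    simp only [hookNum, add_tsub_cancel_right] at *
    rw [h]
    have : 2 * ((r + 1 : ℕ) : ℚ) * k / (k + 1) * p * singleNum p (r + 1) =
      2 * ((r + 1 : ℕ) : ℚ) * k / (k + 1) * p * ((p + 1) * singleNum p r +
        r * ((p + 1) * p) * singleNum p (r - 1)) := by rw [h']
    push_cast at *
    linear_combination (((p + 1) * k).choose k : ℚ) * this

/-! ### Merging a singleton with another balanced cycle -/

namespace AbsB

variable {n : ℕ}

/-- The balanced cycle through the points of the list. -/
def balList : List (SignedPt n) → AbsB n
  | [] => 1
  | x :: l => bal x l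

/-- The product of the balanced cycles of length one through the points of the list. -/
def negProd (l : List (SignedPt n)) : AbsB n := (l.map fun y => refl y (-y)).prod

theorem refl_neg_comm (x y : SignedPt n) : Commute (refl x (-x)) (refl y (-y)) := by
  by_cases h : x.1 = y.1
  · rcases fst_eq_iff.1 h with rfl | rfl
    · exact Commute.refl _
    · rw [neg_neg, refl_comm]
  · have h' : x ≠ y ∧ x ≠ -y := ⟨fun e => h (by rw [e]), fun e => h (by rw [e]; rfl)⟩
    exact commute_refl (neg_smul_of_ne (ne_and_ne_neg_symm h'))
      (smul_eq_of_neg (neg_smul_of_ne (ne_and_ne_neg_symm h')))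

theorem negProd_perm {l l' : List (SignedPt n)} (h : l.Perm l') : negProd l = negProd l' := by
  refine List.Perm.prod_eq' (h.map _) ?_
  rw [List.pairwise_map]
  exact List.pairwise_of_forall fun x y => refl_neg_comm x y

theorem negProd_cons (x : SignedPt n) (l : List (SignedPt n)) :
    negProd (x :: l) = refl x (-x) * negProd l := by simp [negProd]

theorem negProd_smul {z : SignedPt n} {l : List (SignedPt n)} (h : ∀ y ∈ l, z ≠ y ∧ z ≠ -y) :
    negProd l • z = z := by
  induction l with
  | nil => exact one_smul _ _
  | cons x l ih =>
    rw [negProd_cons, mul_smul, ih fun y hy => h y (List.mem_cons_of_mem _ hy),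
      neg_smul_of_ne (h x List.mem_cons_self)]

theorem balList_smul {z : SignedPt n} {l : List (SignedPt n)} (h : ∀ y ∈ l, z ≠ y ∧ z ≠ -y) :
    balList l • z = z := by
  cases l with
  | nil => exact one_smul _ _
  | cons x l => exact bal_smul h

theorem commute_negProd_refl (x : SignedPt n) (l : List (SignedPt n)) :
    Commute (negProd l) (refl x (-x)) := by
  refine Commute.list_prod_left _ _ fun g hg => ?_
  obtain ⟨y, -, rfl⟩ := List.mem_map.1 hg
  exact refl_neg_comm y x

/-- Read from its second entry, the first half of the cycle ends with `-b`. -/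
theorem bal_rotate {b y : SignedPt n} {l : List (SignedPt n)} (h : AbsDistinct (b :: y :: l)) :
    bal b (y :: l) = bal y (l ++ [-b]) := by
  have hby := (absDistinct_cons.1 h).1 y List.mem_cons_self
  have h1 : star b l * refl b y = refl b y * star y l := by
    rw [← refl_mul_star_mul_refl h]; simp [mul_assoc]
  have h2 : refl b y * refl y (-y) = refl b (-b) * refl b y := by
    rw [mul_refl, refl_smul_right, smul_neg_pt, refl_smul_right]
  have h3 := refl_mul_refl_neg b y hby
  have h4 : refl y (-b) = refl b y * (refl b (-b) * refl y (-y)) := by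
    rw [← h3, refl_mul_self_assoc, refl_comm, refl_neg_left]
  have h5 := (refl_neg_comm b y).eq
  rw [bal, star, h1, bal, star_append, star, star, one_mul, h4, h5, ← mul_assoc, ← mul_assoc]
  congr 1
  have h6 : refl y (-y) * refl b y = refl b y * refl b (-b) := by
    rw [mul_refl (refl b y), refl_smul_left, smul_neg_pt, refl_smul_left]
  rw [← mul_assoc, h6, ← h5, mul_assoc, refl_mul_self_assoc, h2]

/-- A balanced cycle can be written starting at any of its points. -/
theorem exists_balList_eq {L : List (SignedPt n)} (h : AbsDistinct L) {y : SignedPt n}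
    (hy : y ∈ L ∨ -y ∈ L) : ∃ l, balList L = bal y l ∧ l.length + 1 = L.length ∧
      AbsDistinct (y :: l) ∧ ∀ z ∈ y :: l, z ∈ L ∨ -z ∈ L := by
  have key : ∀ y (l₁ l₂ : List (SignedPt n)), AbsDistinct (l₁ ++ y :: l₂) →
      ∃ l, balList (l₁ ++ y :: l₂) = bal y l ∧ l.length + 1 = (l₁ ++ y :: l₂).length ∧
      AbsDistinct (y :: l) ∧ ∀ z ∈ y :: l, z ∈ l₁ ++ y :: l₂ ∨ -z ∈ l₁ ++ y :: l₂ := by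
    intro y l₁
    induction l₁ with
    | nil => exact fun l₂ h => ⟨l₂, rfl, rfl, h, fun z hz => Or.inl hz⟩
    | cons b l₁ ih =>
      intro l₂ h
      have hd : AbsDistinct (l₁ ++ y :: (l₂ ++ [-b])) := by
        have e : l₁ ++ y :: (l₂ ++ [-b]) = (l₁ ++ y :: l₂) ++ [-b] := by simp
        rw [e, absDistinct_append]
        rw [List.cons_append, absDistinct_cons] at h
        refine ⟨h.2, List.pairwise_singleton _ _, fun a ha c hc => ?_⟩
        rw [List.mem_singleton.1 hc, neg_neg]
        exact ⟨(ne_and_ne_neg_symm (h.1 a ha)).2, (h.1 a ha).1.symm⟩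
      obtain ⟨l, e1, e2, e3, e4⟩ := ih (l₂ ++ [-b]) hd
      refine ⟨l, ?_, ?_, e3, ?_⟩
      · rw [← e1]
        cases l₁ with
        | nil => exact bal_rotate h
        | cons c l₁ =>
          have := bal_rotate (l := l₁ ++ y :: l₂) h
          rw [List.append_assoc, List.cons_append] at this
          exact this
      · rw [e2]; simp; ring
      · intro z hz
        have := e4 z hz
        simp only [List.mem_append, List.mem_cons, List.not_mem_nil, or_false, neg_inj,
          List.cons_append] at this ⊢
        rcases this with (h | h | h | h) | (h | h | h | h)
        any_goals tauto
        rw [h, neg_neg]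
        tauto
  rcases hy with hy | hy
  · obtain ⟨l₁, l₂, rfl⟩ := List.append_of_mem hy
    exact key y l₁ l₂ h
  · obtain ⟨l₁, l₂, e⟩ := List.append_of_mem hy
    subst e
    obtain ⟨l, e1, e2, e3, e4⟩ := key (-y) l₁ l₂ h
    refine ⟨l.map Neg.neg, ?_, by rw [List.length_map, e2], ?_, ?_⟩
    · rw [e1, ← bal_neg (-y), neg_neg]
    · have := e3.map_neg
      rwa [List.map_cons, neg_neg] at this
    · intro z hz
      have hz' : -z ∈ -y :: l := by
        rcases List.mem_cons.1 hz with rfl | hz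
        · exact List.mem_cons_self
        · obtain ⟨t, ht, rfl⟩ := List.mem_map.1 hz
          rw [neg_neg]
          exact List.mem_cons_of_mem _ ht
      have := e4 _ hz'
      rw [neg_neg] at this
      exact this.symm

/-- Two balanced cycles merge into a paired cycle. -/
theorem refl_neg_mul_bal_mul_refl {x y : SignedPt n} {l : List (SignedPt n)}
    (h : AbsDistinct (x :: y :: l)) :
    refl x (-x) * bal y l * refl x y = star x (l ++ [-y]) := by
  have hxy := (absDistinct_cons.1 h).1 y List.mem_cons_self
  have h1 := refl_mul_star_mul_refl h
  have h2 := refl_mul_refl_neg x (-y) ⟨hxy.2, by rw [neg_neg]; exact hxy.1⟩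
  rw [neg_neg, refl_comm (-y) y] at h2
  rw [star_append, star, star, one_mul, bal, ← h1]
  calc refl x (-x) * (refl y (-y) * (refl x y * star x l * refl x y)) * refl x y
      = (refl x (-x) * refl y (-y)) * (refl x y * star x l) := by simp [mul_assoc]
    _ = _ := by rw [← h2]; simp [mul_assoc]

end AbsB

/-! ### Factorization counts of a balanced cycle times singletons -/

namespace AbsB

variable {n : ℕ}

theorem facCount_at_one (m : ℕ) : facCount m (1 : AbsB n) = 1 := by
  induction m with
  | zero => simp [facCount_zero]
  | succ m ih =>
    have : (Set.toFinite (Set.Iic (1 : AbsB n))).toFinset = {1} := by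
      ext u
      have hu : (1 : AbsB n) ≤ u := (AbsB.instFactOneLe u).out
      simp only [Set.Finite.mem_toFinset, Set.mem_Iic, Finset.mem_singleton]
      exact ⟨fun h => le_antisymm h hu, fun h => h.le⟩
    rw [facCount_succ_apply, this, Finset.sum_singleton, ih]

/-- A balanced cycle has length equal to its number of points and a paired cycle one less, so
merging two balanced cycles lowers the length by one. This serves both for joining two singletons
(`l = []`) and for joining a singleton to the long cycle. -/
theorem starCount_link (p : ℕ) {c : AbsB n} {x y : SignedPt n} {l : List (SignedPt n)}
    (hc : ∀ z ∈ x :: y :: l, c • z = z) (hd : AbsDistinct (x :: y :: l)) (j : ℕ) :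
    len (c * (refl x (-x) * bal y l) * refl x y) + 1 = len (c * (refl x (-x) * bal y l)) ∧
      starCount (p + 1) x j (c * (refl x (-x) * bal y l) * refl x y) =
        facCount (p + 1) c * raney p j (l.length + 1) := by
  have hx := hc x List.mem_cons_self
  obtain ⟨hxl, hyl⟩ := absDistinct_cons.1 hd
  have hd' : AbsDistinct (x :: (l ++ [-y])) := by
    have h1 : AbsDistinct (x :: -y :: l) := by
      refine absDistinct_cons.2 ⟨fun z hz => ?_, absDistinct_cons.2
        ⟨fun z hz => ?_, (absDistinct_cons.1 hyl).2⟩⟩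
      · rcases List.mem_cons.1 hz with rfl | hz
        · rw [neg_neg]
          exact (hxl y List.mem_cons_self).symm
        · exact hxl z (List.mem_cons_of_mem _ hz)
      · have := (absDistinct_cons.1 hyl).1 z hz
        exact ⟨fun e => this.2 (by rw [← e, neg_neg]), fun e => this.1 (neg_injective e)⟩
    refine h1.perm (List.Perm.cons x ?_)
    exact (List.perm_append_singleton (-y) l).symm
  have hc' : ∀ z ∈ x :: (l ++ [-y]), c • z = z := by
    intro z hz
    simp only [List.mem_cons, List.mem_append, List.not_mem_nil, or_false] at hz
    rcases hz with rfl | hz | rfl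
    · exact hx
    · exact hc z (by simp [hz])
    · exact smul_eq_of_neg (hc y (by simp))
  have hf : ∀ z ∈ y :: l, (c * refl x (-x)) • z = z := fun z hz => by
    rw [mul_smul, neg_smul_of_ne (ne_and_ne_neg_symm (hxl z hz)),
      hc z (List.mem_cons_of_mem _ hz)]
  rw [mul_assoc c, refl_neg_mul_bal_mul_refl hd]
  constructor
  · rw [len_mul_star (fun z hz => hc' z (List.mem_cons_of_mem _ hz)) hd', ← mul_assoc,
      len_mul_bal hf hyl, len_mul_refl_of_smul (smul_eq_of_neg hx) (ne_neg x), List.length_append,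
      List.length_singleton]
    ring
  · rw [starCount_mul_star p hc' hd', List.length_append, List.length_singleton]

theorem facCount_balList (p : ℕ) {bl : List (SignedPt n)} (hd : AbsDistinct bl) :
    facCount (p + 1) (balList bl) = ((p + 1) * bl.length).choose bl.length := by
  cases bl with
  | nil => simp [balList, facCount_at_one]
  | cons b l =>
    have := facCount_mul_bal p noBalanced_one (fun z _ => one_smul _ z) hd
    rw [one_mul, facCount_at_one, one_mul] at this
    rw [balList, this, List.length_cons]

/-- Induction on the number of singletons, peeling at one of them. Once `[x]` is merged with the
long cycle only singletons remain beside the paired cycle, whence the factor `singleNum`. -/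
theorem facCount_hook (p : ℕ) (ys bl : List (SignedPt n)) (hd : AbsDistinct (bl ++ ys)) :
    facCount (p + 1) (balList bl * negProd ys) = hookNum p bl.length ys.length := by
  induction hs : ys.length using Nat.strong_induction_on generalizing ys bl with
  | _ s ih =>
  cases ys with
  | nil =>
    rw [List.append_nil] at hd
    subst hs
    rw [negProd, List.map_nil, List.prod_nil, mul_one, facCount_balList p hd, List.length_nil,
      hookNum_zero_right]
  | cons x ys =>
    have hdx : AbsDistinct (x :: (ys ++ bl)) :=
      hd.perm (List.perm_append_comm.trans (by rw [List.cons_append]))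
    obtain ⟨hx, hyb⟩ := absDistinct_cons.1 hdx
    have hdW : AbsDistinct (bl ++ ys) := hyb.perm List.perm_append_comm
    have hW : (balList bl * negProd ys) • x = x := by
      rw [mul_smul, negProd_smul fun y hy => hx y (List.mem_append_left _ hy),
        balList_smul fun y hy => hx y (List.mem_append_right _ hy)]
    have hl : ys.length < s := by rw [← hs, List.length_cons]; exact Nat.lt_succ_self _
    have e0 : balList bl * negProd (x :: ys) = balList bl * negProd ys * refl x (-x) := by
      rw [negProd_cons, ← (commute_negProd_refl x ys).eq, mul_assoc]
    -- Deleting `[x]` leaves an element fixing `x`, whose star count does not depend on `j`.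
    have hself : ∀ j, len (balList bl * negProd (x :: ys) * refl x (-x)) + 1 =
          len (balList bl * negProd (x :: ys)) ∧
        starCount (p + 1) x j (balList bl * negProd (x :: ys) * refl x (-x)) =
          hookNum p bl.length ys.length := by
      intro j
      rw [e0, mul_assoc _ (refl x (-x)), refl_mul_self, mul_one,
        len_mul_refl_of_smul (smul_eq_of_neg hW) (ne_neg x), starCount_of_smul p hW,
        ih _ hl ys bl hdW rfl]
      exact ⟨rfl, rfl⟩
    have hsing : ∀ y, y ∈ ys ∨ -y ∈ ys → ∀ j,
        len (balList bl * negProd (x :: ys) * refl x y) + 1 =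
          len (balList bl * negProd (x :: ys)) ∧
        starCount (p + 1) x j (balList bl * negProd (x :: ys) * refl x y) =
          hookNum p bl.length (ys.length - 1) * raney p j 1 := by
      intro y hy j
      obtain ⟨t, ht, hyt⟩ : ∃ t ∈ ys, y = t ∨ y = -t := by
        rcases hy with hy | hy
        · exact ⟨y, hy, Or.inl rfl⟩
        · exact ⟨-y, hy, Or.inr (neg_neg y).symm⟩
      have hN : refl t (-t) = refl y (-y) := by
        rcases hyt with rfl | rfl
        · rfl
        · rw [neg_neg, refl_comm]
      have hp := List.perm_cons_erase ht
      have hdp : AbsDistinct (t :: ((ys.erase t) ++ bl)) := by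
        refine hyb.perm ?_
        rw [← List.cons_append]
        exact hp.append_right bl
      have hpt := (absDistinct_cons.1 hdp).1
      have hpy : ∀ z ∈ ys.erase t ++ bl, y ≠ z ∧ y ≠ -z := by
        intro z hz
        have := hpt z hz
        rcases hyt with rfl | rfl
        · exact this
        · exact ⟨fun e => this.2 (by rw [← e, neg_neg]), fun e => this.1 (neg_injective e)⟩
      have e1 : balList bl * negProd (x :: ys) =
          balList bl * negProd (ys.erase t) * (refl x (-x) * bal y []) := by
        rw [negProd_perm (hp.cons x), negProd_cons, negProd_cons, hN, bal_nil,
          ← (commute_negProd_refl y (ys.erase t)).eq, ← mul_assoc (refl x (-x)),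
          ← (commute_negProd_refl x (ys.erase t)).eq]
        simp only [mul_assoc]
      have hxt := hx t (List.mem_append_left _ ht)
      have hxy : x ≠ y ∧ x ≠ -y := by
        rcases hyt with rfl | rfl
        · exact hxt
        · rw [neg_neg]; exact hxt.symm
      have hc : ∀ z ∈ [x, y], (balList bl * negProd (ys.erase t)) • z = z := by
        intro z hz
        have hz' : ∀ u ∈ ys.erase t ++ bl, z ≠ u ∧ z ≠ -u := by
          rcases List.mem_cons.1 hz with rfl | hz
          · intro u hu
            refine hx u ?_
            rcases List.mem_append.1 hu with hu | hu
            · exact List.mem_append_left _ (List.mem_of_mem_erase hu)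
            · exact List.mem_append_right _ hu
          · rw [List.mem_singleton.1 hz]
            exact hpy
        rw [mul_smul, negProd_smul fun u hu => hz' u (List.mem_append_left _ hu),
          balList_smul fun u hu => hz' u (List.mem_append_right _ hu)]
      have hlt : (ys.erase t).length = ys.length - 1 := List.length_erase_of_mem ht
      have h := starCount_link p hc
        (absDistinct_cons.2 ⟨by simpa using hxy, List.pairwise_singleton _ _⟩) j
      rw [← e1, ih _ (by omega) (ys.erase t) bl
        (((absDistinct_cons.1 hdp).2).perm List.perm_append_comm) rfl, hlt] at h
      exact h
    have hbal : ∀ y, y ∈ bl ∨ -y ∈ bl → ∀ j,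
        len (balList bl * negProd (x :: ys) * refl x y) + 1 =
          len (balList bl * negProd (x :: ys)) ∧
        starCount (p + 1) x j (balList bl * negProd (x :: ys) * refl x y) =
          singleNum p ys.length * raney p j bl.length := by
      intro y hy j
      -- The long cycle is rewritten to start at `y`, of either sign, so that the merge applies.
      obtain ⟨l, e1, e2, e3, e4⟩ := exists_balList_eq (absDistinct_append.1 hdW).1 hy
      have hoff : ∀ u ∈ x :: ys, ∀ z ∈ y :: l, u ≠ z ∧ u ≠ -z := by
        intro u hu z hz
        have hub : ∀ w ∈ bl, u ≠ w ∧ u ≠ -w := fun w hw =>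
          ne_and_ne_neg_symm ((absDistinct_append.1 hd).2.2 w hw u hu)
        rcases e4 z hz with h | h
        · exact hub z h
        · have := hub _ h
          rw [neg_neg] at this
          exact this.symm
      have hfix : ∀ z ∈ y :: l, (negProd ys * refl x (-x)) • z = z := by
        intro z hz
        rw [mul_smul, neg_smul_of_ne (ne_and_ne_neg_symm (hoff x List.mem_cons_self z hz)),
          negProd_smul fun u hu => ne_and_ne_neg_symm (hoff u (List.mem_cons_of_mem _ hu) z hz)]
      have e5 : balList bl * negProd (x :: ys) = negProd ys * (refl x (-x) * bal y l) := by
        rw [e0, e1, mul_assoc, ← (commute_bal hfix).eq, mul_assoc]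
      have hc : ∀ z ∈ x :: y :: l, negProd ys • z = z := by
        intro z hz
        refine negProd_smul fun u hu => ?_
        rcases List.mem_cons.1 hz with rfl | hz
        · exact hx u (List.mem_append_left _ hu)
        · exact ne_and_ne_neg_symm (hoff u (List.mem_cons_of_mem _ hu) z hz)
      have h := starCount_link p hc (absDistinct_cons.2 ⟨hoff x List.mem_cons_self, e3⟩) j
      have h0 := ih _ hl ys [] (absDistinct_append.1 hdW).2.1 rfl
      rw [balList, one_mul, List.length_nil, hookNum_zero_left] at h0
      rw [← e5, h0, e2] at h
      exact h
    -- The three kinds of peeling accumulated over `j` steps; each factor 2 counts the two signs of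
    -- the partner `±y`.
    have hstep : ∀ j, starCount (p + 1) x j (balList bl * negProd (x :: ys)) =
        j * hookNum p bl.length ys.length +
        2 * ys.length * (∑ i ∈ Finset.range j, raney p i 1) * hookNum p bl.length (ys.length - 1) +
        2 * bl.length * (∑ i ∈ Finset.range j, raney p i bl.length) *
          singleNum p ys.length := by
      intro j
      induction j with
      | zero =>
        rw [starCount_zero, restr_of_ne]
        · simp
        · rw [e0, mul_smul, refl_smul_left, smul_eq_of_neg hW]
          exact (ne_neg x).symm
      | succ j ihj =>
        classical
        rw [starCount_succ, ihj, Finset.sum_range_succ, Finset.sum_range_succ,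
          sum_filter_eq_sum_list _ hdx.nodup_signed, List.map_cons, List.sum_cons, (hself j).2,
          List.map_append, List.map_append, List.map_append, List.map_append, List.sum_append,
          List.sum_append, List.sum_append,
          sum_list_const ys _ _ fun y hy => (hsing y (Or.inl hy) j).2,
          sum_list_const bl _ _ fun y hy => (hbal y (Or.inl hy) j).2,
          sum_list_const (ys.map Neg.neg) _ (hookNum p bl.length (ys.length - 1) * raney p j 1),
          sum_list_const (bl.map Neg.neg) _ (singleNum p ys.length * raney p j bl.length),
          List.length_map, List.length_map]
        · push_cast
          ring
        · intro y hy
          obtain ⟨t, ht, rfl⟩ := List.mem_map.1 hy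
          exact (hbal _ (Or.inr (by rwa [neg_neg])) j).2
        · intro y hy
          obtain ⟨t, ht, rfl⟩ := List.mem_map.1 hy
          exact (hsing _ (Or.inr (by rwa [neg_neg])) j).2
        · intro y
          have hmem : y ∈ (ys ++ bl).map Neg.neg ↔ -y ∈ ys ++ bl := by
            rw [List.mem_map]
            exact ⟨fun ⟨t, ht, e⟩ => by rwa [← e, neg_neg], fun h => ⟨-y, h, neg_neg y⟩⟩
          rw [List.mem_cons, List.mem_append, hmem, List.mem_append, List.mem_append]
          constructor
          · rintro ⟨hy, hlen⟩
            by_contra hn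
            have hfix : (balList bl * negProd (x :: ys)) • y = y := by
              have hne : ∀ u ∈ ys ++ bl, y ≠ u ∧ y ≠ -u := by
                intro u hu
                rw [List.mem_append] at hu
                constructor
                · rintro rfl; tauto
                · rintro rfl; rw [neg_neg] at hn; tauto
              rw [mul_smul, negProd_smul, balList_smul]
              · exact fun u hu => hne u (List.mem_append_right _ hu)
              · intro u hu
                rcases List.mem_cons.1 hu with rfl | hu
                · exact ⟨hy, fun e => hn (Or.inl e)⟩
                · exact hne u (List.mem_append_left _ hu)
            have := len_mul_refl_of_smul (w := balList bl * negProd (x :: ys)) hfix hy.symm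
            omega
          · rintro (rfl | (h | h) | (h | h))
            · exact ⟨(ne_neg x).symm, (hself 0).1⟩
            · exact ⟨(hx y (List.mem_append_left _ h)).1.symm, (hsing y (Or.inl h) 0).1⟩
            · exact ⟨(hx y (List.mem_append_right _ h)).1.symm, (hbal y (Or.inl h) 0).1⟩
            · refine ⟨fun e => (hx _ (List.mem_append_left _ h)).2 ?_, (hsing y (Or.inr h) 0).1⟩
              rw [e, neg_neg]
            · refine ⟨fun e => (hx _ (List.mem_append_right _ h)).2 ?_, (hbal y (Or.inr h) 0).1⟩
              rw [e, neg_neg]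
    have hsum : 2 * ∑ i ∈ Finset.range (p + 1), raney p i 1 = (p + 1) * p := by
      simp only [raney_one]
      have := Finset.sum_range_id_mul_two (p + 1)
      rw [add_tsub_cancel_right] at this
      have h' := congrArg (Nat.cast : ℕ → ℚ) this
      push_cast at h'
      linear_combination h'
    rw [← starCount_self (p + 1) x, hstep, sum_range_raney, ← hs, List.length_cons, hookNum_succ]
    push_cast
    linear_combination (ys.length * hookNum p bl.length (ys.length - 1)) * hsum

end AbsB

/-! ### Multichains, the zeta polynomial and the Möbius number -/

section Multichains

variable {P : Type*} [PartialOrder P]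

/-- The number of multichains with `j` elements all of whose elements are at most `y`. -/
noncomputable def multichainsBelow (j : ℕ) (y : P) : ℕ :=
  Nat.card {f : Fin j → P // Monotone f ∧ ∀ i, f i ≤ y}

theorem multichainsBelow_zero (y : P) : multichainsBelow 0 y = 1 :=
  Nat.card_eq_one_iff_unique.2 ⟨⟨fun _ _ => Subtype.ext (funext fun i => i.elim0)⟩,
    ⟨⟨fun i => i.elim0, fun i => i.elim0, fun i => i.elim0⟩⟩⟩

theorem multichainCount_eq_multichainsBelow {S : Set P} {y : P} (h : ∀ x, x ∈ S ↔ x ≤ y) (j : ℕ) :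
    multichainCount S j = multichainsBelow j y :=
  Nat.card_congr
    { toFun := fun f => ⟨fun i => f i, fun _ _ hab => f.monotone hab, fun i => (h _).1 (f i).2⟩
      invFun := fun f => ⟨fun i => ⟨f.1 i, (h _).2 (f.2.2 i)⟩, fun _ _ hab => f.2.1 hab⟩
      left_inv := fun _ => rfl
      right_inv := fun _ => rfl }

theorem multichainCount_eq_multichainsBelow_top [OrderTop P] (j : ℕ) :
    multichainCount P j = multichainsBelow j (⊤ : P) :=
  Nat.card_congr
    { toFun := fun f => ⟨f, f.monotone, fun _ => le_top⟩
      invFun := fun f => ⟨f.1, f.2.1⟩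
      left_inv := fun _ => rfl
      right_inv := fun _ => rfl }

theorem multichainsBelow_succ [Finite P] (j : ℕ) (y : P) :
    multichainsBelow (j + 1) y =
      ∑ u ∈ (Set.toFinite (Set.Iic y)).toFinset, multichainsBelow j u := by
  have e : {f : Fin (j + 1) → P // Monotone f ∧ ∀ i, f i ≤ y} ≃
      Σ u : {u // u ≤ y}, {f : Fin j → P // Monotone f ∧ ∀ i, f i ≤ u.1} :=
    { toFun := fun f => ⟨⟨f.1 (Fin.last j), f.2.2 _⟩, fun i => f.1 i.castSucc,
        fun a b hab => f.2.1 (Fin.castSucc_le_castSucc_iff.2 hab), fun i => f.2.1 (Fin.le_last _)⟩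
      invFun := fun s => ⟨Fin.snoc (α := fun _ => P) s.2.1 s.1.1, by
        constructor
        · intro a b hab
          induction b using Fin.lastCases with
          | last =>
            rw [Fin.snoc_last]
            induction a using Fin.lastCases with
            | last => rw [Fin.snoc_last]
            | cast a => rw [Fin.snoc_castSucc]; exact s.2.2.2 a
          | cast b =>
            induction a using Fin.lastCases with
            | last => exact absurd hab (not_le.2 (Fin.castSucc_lt_last b))
            | cast a =>
              rw [Fin.snoc_castSucc, Fin.snoc_castSucc]
              exact s.2.2.1 (Fin.castSucc_le_castSucc_iff.1 hab)
        · intro a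
          induction a using Fin.lastCases with
          | last => rw [Fin.snoc_last]; exact s.1.2
          | cast a => rw [Fin.snoc_castSucc]; exact (s.2.2.2 a).trans s.1.2⟩
      left_inv := fun f => Subtype.ext (Fin.snoc_init_self f.1)
      right_inv := by
        rintro ⟨⟨u, hu⟩, f, hf, h⟩
        refine Sigma.subtype_ext (Subtype.ext (Fin.snoc_last (α := fun _ => P) u f)) ?_
        exact Fin.init_snoc (α := fun _ => P) u f }
  have := Fintype.ofFinite P
  classical
  rw [multichainsBelow, Nat.card_congr e, Nat.card_sigma]
  exact (Finset.sum_subtype _ (by simp) (fun u => multichainsBelow j u)).symm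

variable [Finite P]

/-- Uniqueness in Möbius inversion, by induction from below. It allows the recursion for multichains
to be run backwards to nonpositive arguments. -/
theorem eq_of_sum_Iic_eq {f g : P → ℚ}
    (h : ∀ y, ∑ u ∈ (Set.toFinite (Set.Iic y)).toFinset, f u =
      ∑ u ∈ (Set.toFinite (Set.Iic y)).toFinset, g u) : f = g := by
  classical
  funext y
  induction y using WellFoundedLT.induction with
  | _ y ih =>
    have hy := h y
    have hm : y ∈ (Set.toFinite (Set.Iic y)).toFinset := by simp
    rw [← Finset.add_sum_erase _ _ hm, ← Finset.add_sum_erase _ g hm,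
      Finset.sum_congr rfl fun u hu => ih u ?_] at hy
    · exact add_right_cancel hy
    · obtain ⟨h1, h2⟩ := Finset.mem_erase.1 hu
      exact lt_of_le_of_ne (by simpa using h2) h1

/-- The polynomial counting multichains below `y`. -/
noncomputable def belowPoly (y : P) : Polynomial ℚ :=
  (zetaPolynomial (Set.Iic y)).comp (Polynomial.X + 1)

theorem belowPoly_eval (y : P) {j : ℕ} (hj : 1 ≤ j) :
    (belowPoly y).eval (j : ℚ) = multichainsBelow j y := by
  have := zetaPolynomial_eval (Set.Iic y) (m := j + 1) (by omega)
  rw [add_tsub_cancel_right, multichainCount_eq_multichainsBelow fun _ => Set.mem_Iic] at this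
  rw [belowPoly, Polynomial.eval_comp, ← this]
  simp

/-- Classifying multichains by their largest element gives the identity at every `j ≥ 1`, hence as
polynomials. -/
theorem sum_belowPoly (y : P) : ∑ u ∈ (Set.toFinite (Set.Iic y)).toFinset, belowPoly u =
    (belowPoly y).comp (Polynomial.X + 1) := by
  refine Polynomial.eq_of_infinite_eval_eq _ _ (Set.Infinite.mono (s := Nat.cast '' Set.Ici 1) ?_
    ((Set.Ici_infinite 1).image Nat.cast_injective.injOn))
  rintro _ ⟨j, hj, rfl⟩
  have h := belowPoly_eval y (j := j + 1) (by omega)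
  rw [multichainsBelow_succ] at h
  change Polynomial.eval _ _ = Polynomial.eval _ _
  rw [Polynomial.eval_finsetSum, Polynomial.eval_comp, Polynomial.eval_add, Polynomial.eval_X,
    Polynomial.eval_one]
  push_cast at h
  rw [h]
  exact Finset.sum_congr rfl fun u _ => belowPoly_eval u hj

theorem sum_belowPoly_eval (y : P) (a b : ℚ) (h : b = a + 1) :
    ∑ u ∈ (Set.toFinite (Set.Iic y)).toFinset, (belowPoly u).eval a = (belowPoly y).eval b := by
  rw [← Polynomial.eval_finsetSum, sum_belowPoly, Polynomial.eval_comp, h]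
  simp

theorem belowPoly_eval_zero (y : P) : (belowPoly y).eval 0 = 1 := by
  refine congrFun (eq_of_sum_Iic_eq (f := fun y : P => (belowPoly y).eval 0) (g := fun _ => 1)
    fun y => ?_) y
  have h := belowPoly_eval y le_rfl
  rw [multichainsBelow_succ] at h
  rw [sum_belowPoly_eval y 0 ((1 : ℕ) : ℚ) (by simp), h]
  simp [multichainsBelow_zero]

open scoped Classical in
theorem belowPoly_eval_neg_one [OrderBot P] (y : P) :
    (belowPoly y).eval (-1) = if y = ⊥ then 1 else 0 := by
  refine congrFun (eq_of_sum_Iic_eq (f := fun y : P => (belowPoly y).eval (-1))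
    (g := fun y => if y = ⊥ then 1 else 0) fun y => ?_) y
  rw [sum_belowPoly_eval y (-1) 0 (by norm_num), belowPoly_eval_zero]
  simp

/-- Summation over principal ideals raises the argument of `belowPoly` by one. Going down from 1,
the values at `0`, `-1`, `-2` are the constant 1, the delta function at `⊥` and `μ(⊥, ·)`; the shift
by one turns `-2` into the argument `-1` of the zeta polynomial. -/
theorem mobiusNumber_eq_eval [BoundedOrder P] :
    (mobiusNumber P : ℚ) = (zetaPolynomial P).eval (-1) := by
  classical
  have hz : zetaPolynomial P = zetaPolynomial (Set.Iic (⊤ : P)) := by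
    refine eq_zetaPolynomial _ fun m hm => ?_
    rw [zetaPolynomial_eval P hm, multichainCount_eq_multichainsBelow_top,
      multichainCount_eq_multichainsBelow fun _ => Set.mem_Iic]
  have ht : (zetaPolynomial P).eval (-1) = (belowPoly (⊤ : P)).eval (-2) := by
    rw [hz, belowPoly, Polynomial.eval_comp]
    norm_num
  rw [ht, mobiusNumber]
  let := Fintype.ofFinite P
  let : LocallyFiniteOrder P := Fintype.toLocallyFiniteOrder
  refine (congrFun (eq_of_sum_Iic_eq (f := fun y : P => (belowPoly y).eval (-2))
    (g := fun y => ((IncidenceAlgebra.mu ℤ (⊥ : P) y : ℤ) : ℚ)) fun y => ?_) ⊤).symm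
  rw [sum_belowPoly_eval y (-2) (-1) (by norm_num), belowPoly_eval_neg_one]
  have h : (Set.toFinite (Set.Iic y)).toFinset = Finset.Icc ⊥ y := by ext; simp
  rw [h, ← Int.cast_sum, IncidenceAlgebra.sum_Icc_mu_right]
  simp [eq_comm]

end Multichains

/-! ### Cycle notation and the count for `hookElement` -/

/-- `List.formPerm` unfolds with the transposition on the left, while `star` adds its reflections on
the right; this is the right-handed unfolding. -/
theorem formPerm_cons_cons_eq_mul_swap {α : Type*} [DecidableEq α] {x y : α} {l : List α}
    (h : (x :: y :: l).Nodup) :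
    (x :: y :: l).formPerm = (x :: l).formPerm * swap x y := by
  obtain ⟨hx, hy⟩ := List.nodup_cons.1 h
  have hy' := (List.nodup_cons.1 hy).1
  rw [List.mem_cons, not_or] at hx
  cases l with
  | nil => simp
  | cons z l =>
    rw [List.formPerm_cons_cons, List.formPerm_cons_cons, List.formPerm_cons_cons, mul_assoc,
      Equiv.mul_swap_eq_swap_mul (List.formPerm (z :: l)), List.formPerm_apply_of_notMem hx.2,
      List.formPerm_apply_of_notMem hy', ← mul_assoc, ← mul_assoc]
    congr 1
    rw [Equiv.mul_swap_eq_swap_mul (swap x y), swap_apply_right, swap_apply_of_ne_of_ne]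
    · exact fun e => hx.2 (by simp [e])
    · exact fun e => hy' (by simp [e])

namespace AbsB

variable {n : ℕ}

theorem toPerm_mul (u v : AbsB n) : (u * v).toPerm = u.toPerm * v.toPerm := rfl

theorem balancedCycle_eq_toPerm_bal {x : SignedPt n} {l : List (SignedPt n)}
    (h : AbsDistinct (x :: l)) : balancedCycle (x :: l) = (bal x l).toPerm := by
  induction l with
  | nil => rw [bal_nil, toPerm_refl_neg]; simp [balancedCycle]
  | cons y l ih =>
    have hxy := (absDistinct_cons.1 h).1 y List.mem_cons_self
    have h' : AbsDistinct (x :: l) := h.sublist ((List.sublist_cons_self y l).cons_cons x)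
    have e : bal x (y :: l) = bal x l * refl x y := by rw [bal, star, ← mul_assoc, bal]
    rw [e, toPerm_mul, ← ih h', toPerm_refl (ne_and_ne_neg_symm hxy).2]
    have hn := h.nodup_append_map_neg
    simp only [List.map_cons, List.cons_append] at hn
    have hs : (x :: (l ++ -x :: -y :: l.map Neg.neg)).Nodup :=
      hn.sublist ((List.sublist_cons_self y _).cons_cons x)
    have hr : (-x :: -y :: (l.map Neg.neg ++ x :: l)).Nodup := by
      refine (List.Perm.nodup_iff ?_).1 hs
      exact (List.perm_append_comm (l₁ := x :: l) (l₂ := -x :: -y :: l.map Neg.neg))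
    -- After `y` is removed, a half-turn brings `-x, -y` to the front so that `-y` can be removed
    -- too; `e2` turns back.
    have e1 : (x :: (l ++ -x :: -y :: l.map Neg.neg)).formPerm =
        (-x :: -y :: (l.map Neg.neg ++ x :: l)).formPerm := by
      have := List.formPerm_rotate _ hs (x :: l).length
      rw [← this]
      congr 1
      exact List.rotate_append_length_eq (x :: l) (-x :: -y :: l.map Neg.neg)
    have hr' : (-x :: (l.map Neg.neg ++ x :: l)).Nodup :=
      hr.sublist ((List.sublist_cons_self (-y) _).cons_cons (-x))
    have e2 : (-x :: (l.map Neg.neg ++ x :: l)).formPerm =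
        (x :: (l ++ -x :: l.map Neg.neg)).formPerm := by
      have := List.formPerm_rotate _ hr' (-x :: l.map Neg.neg).length
      rw [← this]
      congr 1
      exact List.rotate_append_length_eq (-x :: l.map Neg.neg) (x :: l)
    simp only [balancedCycle, List.map_cons, List.cons_append]
    rw [formPerm_cons_cons_eq_mul_swap hn, e1, formPerm_cons_cons_eq_mul_swap hr, e2]
    have hcomm : Commute (swap x y) (swap (-x) (-y)) := by
      have h1 : swap x y (-x) = -x :=
        swap_apply_of_ne_of_ne (ne_neg x).symm fun e => hxy.2 (by rw [← e, neg_neg])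
      have h2 : swap x y (-y) = -y :=
        swap_apply_of_ne_of_ne hxy.2.symm (ne_neg y).symm
      rw [commute_iff_eq, Equiv.mul_swap_eq_swap_mul, h1, h2]
    rw [mul_assoc, hcomm.eq]

theorem balancedCycle_eq_toPerm_balList {l : List (SignedPt n)} (h : AbsDistinct l) :
    balancedCycle l = (balList l).toPerm := by
  cases l with
  | nil => rfl
  | cons x l => exact balancedCycle_eq_toPerm_bal h

theorem prod_balancedCycle_eq_toPerm_negProd {α : Type*} (l : List α) (f : α → SignedPt n) :
    (l.map fun j => balancedCycle [f j]).prod = (negProd (l.map f)).toPerm := by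
  induction l with
  | nil => rfl
  | cons a l ih =>
    rw [List.map_cons, List.prod_cons, ih, List.map_cons, negProd_cons, toPerm_mul,
      toPerm_refl_neg]
    simp [balancedCycle]

theorem absDistinct_map_pos {l : List (Fin n)} (h : l.Nodup) : AbsDistinct (l.map pos) := by
  rw [AbsDistinct, List.pairwise_map]
  exact List.Pairwise.imp
    (fun h => ⟨fun e => h (pos_injective e), pos_ne_neg_pos _ _⟩) h

theorem hookElement_eq (k r : ℕ) : hookElement k r =
    balList (((List.finRange k).map (Fin.castAdd r)).map pos) *
      negProd ((List.finRange r).map fun j => pos (Fin.natAdd k j)) := by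
  refine Subtype.ext ?_
  change _ * _ = toPerm (_ * _)
  rw [toPerm_mul, ← prod_balancedCycle_eq_toPerm_negProd, ← balancedCycle_eq_toPerm_balList]
  exact absDistinct_map_pos ((List.nodup_finRange k).map (Fin.castAdd_injective k r))

theorem facCount_hookElement (p k r : ℕ) :
    facCount (p + 1) (hookElement k r) = hookNum p k r := by
  rw [hookElement_eq, facCount_hook]
  · simp
  · have e : ((List.finRange r).map fun j => pos (Fin.natAdd k j)) =
        (((List.finRange r).map (Fin.natAdd k)).map pos : List (SignedPt (k + r))) := by
      rw [List.map_map]; rfl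
    rw [e, ← List.map_append]
    refine absDistinct_map_pos (List.nodup_append.2
      ⟨(List.nodup_finRange k).map (Fin.castAdd_injective k r),
        (List.nodup_finRange r).map (Fin.natAdd_injective r k), ?_⟩)
    rintro a ha b hb rfl
    obtain ⟨i, -, rfl⟩ := List.mem_map.1 ha
    obtain ⟨j, -, h⟩ := List.mem_map.1 hb
    have := congrArg Fin.val h
    simp at this
    omega

/-- The `j` proper partial products of a factorization into `j + 1` factors form a multichain; both
counts obey the same recursion. -/
theorem facCount_eq_multichainsBelow (j : ℕ) (w : AbsB n) :
    facCount (j + 1) w = multichainsBelow j w := by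
  induction j generalizing w with
  | zero => rw [facCount_one, multichainsBelow_zero, Nat.cast_one]
  | succ j ih =>
    rw [facCount_succ_apply, multichainsBelow_succ, Nat.cast_sum]
    exact Finset.sum_congr rfl fun u _ => ih u

end AbsB

/-! ### From counts at integers to the three formulas -/

open AbsB

theorem multichainCount_intervalL (k r p : ℕ) :
    (multichainCount (IntervalL k r) p : ℚ) = hookNum p k r := by
  rw [multichainCount_eq_multichainsBelow (y := hookElement k r), ← facCount_eq_multichainsBelow,
    facCount_hookElement]
  intro x
  have : (1 : AbsB (k + r)) ≤ x := (AbsB.instFactOneLe x).out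
  simp [this]

theorem eval_zetaPolynomial_intervalL (k r : ℕ) {p : ℕ} (hp : 1 ≤ p) :
    (zetaPolynomial (IntervalL k r)).eval ((p : ℚ) + 1) = hookNum p k r := by
  have := zetaPolynomial_eval (IntervalL k r) (m := p + 1) (by omega)
  rw [add_tsub_cancel_right, multichainCount_intervalL] at this
  exact_mod_cast this

theorem eval_zetaPolynomial_posetL (r : ℕ) {p : ℕ} (hp : 1 ≤ p) :
    (zetaPolynomial (PosetL r)).eval ((p : ℚ) + 1) = singleNum p r := by
  rw [eval_zetaPolynomial_intervalL 0 r hp, hookNum_zero_left]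

theorem polynomial_eq_of_eval_succ {f g : Polynomial ℚ}
    (h : ∀ p : ℕ, 1 ≤ p → f.eval ((p : ℚ) + 1) = g.eval ((p : ℚ) + 1)) : f = g := by
  refine Polynomial.eq_of_infinite_eval_eq _ _ (Set.Infinite.mono
    (s := (fun p : ℕ => (p : ℚ) + 1) '' Set.Ici 1) ?_ ((Set.Ici_infinite 1).image ?_))
  · rintro _ ⟨p, hp, rfl⟩
    exact h p hp
  · intro a _ b _ e
    simpa using e

theorem card_intervalL (k r : ℕ) : (Nat.card (IntervalL k r) : ℚ) = hookNum 1 k r := by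
  rw [← multichainCount_intervalL, multichainCount]
  congr 1
  exact Nat.card_congr
    { toFun := fun x => ⟨fun _ => x, monotone_const⟩
      invFun := fun f => f 0
      left_inv := fun _ => rfl
      right_inv := fun f => OrderHom.ext _ _ (funext fun i => by rw [Subsingleton.elim i 0]; rfl) }

theorem zetaPolynomial_posetL_zero : zetaPolynomial (PosetL 0) = 1 :=
  polynomial_eq_of_eval_succ fun p hp => by
    rw [eval_zetaPolynomial_posetL 0 hp]; simp [singleNum]

theorem zetaPolynomial_posetL_one : zetaPolynomial (PosetL 1) = Polynomial.X :=
  polynomial_eq_of_eval_succ fun p hp => by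
    rw [eval_zetaPolynomial_posetL 1 hp]; simp [singleNum]

theorem zetaPolynomial_posetL_add_two (r : ℕ) : zetaPolynomial (PosetL (r + 2)) =
    Polynomial.X * zetaPolynomial (PosetL (r + 1)) +
      Polynomial.C (r + 1 : ℚ) * (Polynomial.X * (Polynomial.X - 1)) * zetaPolynomial (PosetL r) :=
  polynomial_eq_of_eval_succ fun p hp => by
    rw [eval_zetaPolynomial_posetL (r + 2) hp]
    simp [singleNum, eval_zetaPolynomial_posetL _ hp]

/-- At `-1` the two coefficients of the recursion are `-1` and `2 (r + 1)`, so the signs alternate.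
Two consecutive indices are carried because the recursion has depth two. -/
theorem neg_one_pow_mul_eval_neg_one_nonneg (r : ℕ) :
    0 ≤ (-1) ^ r * (zetaPolynomial (PosetL r)).eval (-1) ∧
      0 ≤ (-1) ^ (r + 1) * (zetaPolynomial (PosetL (r + 1))).eval (-1) := by
  induction r with
  | zero => simp [zetaPolynomial_posetL_zero, zetaPolynomial_posetL_one]
  | succ r ih =>
    refine ⟨ih.2, ?_⟩
    have e : (-1 : ℚ) ^ (r + 1 + 1) * (zetaPolynomial (PosetL (r + 1 + 1))).eval (-1) =
        (-1) ^ (r + 1) * (zetaPolynomial (PosetL (r + 1))).eval (-1) +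
          2 * (r + 1) * ((-1) ^ r * (zetaPolynomial (PosetL r)).eval (-1)) := by
      rw [zetaPolynomial_posetL_add_two]
      simp
      ring
    rw [e]
    have := ih.1
    have := ih.2
    positivity

theorem eval_neg_one_eq_abs (r : ℕ) : (zetaPolynomial (PosetL r)).eval (-1) =
    (-1) ^ r * |(mobiusNumber (PosetL r) : ℚ)| := by
  have h := (neg_one_pow_mul_eval_neg_one_nonneg r).1
  rw [mobiusNumber_eq_eval]
  rcases neg_one_pow_eq_or ℚ r with e | e
  · rw [e, one_mul] at h
    rw [e, one_mul, abs_of_nonneg h]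
  · rw [e] at h
    rw [e, abs_of_nonpos (by linarith)]
    ring

/-- Polynomiality in `m` carries an identity checked at integers `m ≥ 2` over to all rational `m`,
in particular `-1`. -/
theorem exists_polynomial_ring_choose (k : ℕ) :
    ∃ q : Polynomial ℚ, ∀ m : ℚ, q.eval m = Ring.choose (m * k) k := by
  refine ⟨Polynomial.C ((k.factorial : ℚ)⁻¹) * ((descPochhammer ℤ k).map (algebraMap ℤ ℚ)).comp
    (Polynomial.X * Polynomial.C (k : ℚ)), fun m => ?_⟩
  have h := Ring.descPochhammer_eq_factorial_smul_choose (m * k) k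
  have hk : (k.factorial : ℚ) ≠ 0 := by exact_mod_cast k.factorial_ne_zero
  rw [Polynomial.eval_mul, Polynomial.eval_C, Polynomial.eval_comp, Polynomial.eval_mul,
    Polynomial.eval_X, Polynomial.eval_C, Polynomial.eval_map_algebraMap,
    Polynomial.aeval_eq_smeval, h, nsmul_eq_mul, inv_mul_cancel_left₀ hk]

/-- Negation of the upper index. At `k = 0` the truncated `2 * k - 1` is 0, and `C(0, 0) = 1` agrees
with the convention `C(-1, 0) = 1`. -/
theorem ring_choose_neg_self (k : ℕ) :
    Ring.choose (-1 * k : ℚ) k = (-1) ^ k * ((2 * k - 1).choose k : ℚ) := by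
  cases k with
  | zero => simp
  | succ k =>
    have e : ((k + 1 : ℕ) : ℚ) + (k + 1 : ℕ) - 1 = ((2 * (k + 1) - 1 : ℕ) : ℚ) := by
      rw [show 2 * (k + 1) - 1 = 2 * k + 1 by omega]
      push_cast
      ring
    rw [neg_one_mul, Ring.choose_neg, e, Ring.choose_natCast, Int.negOnePow_def, zpow_natCast,
      Units.smul_def]
    simp

theorem eval_zetaPolynomial_intervalL_eq (k r : ℕ) (m : ℚ) :
    (zetaPolynomial (IntervalL k r)).eval m =
      Ring.choose (m * k) k *
        (2 * r * k / (k + 1) * (m - 1) * (zetaPolynomial (PosetL (r - 1))).eval m +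
          (zetaPolynomial (PosetL r)).eval m) := by
  obtain ⟨q, hq⟩ := exists_polynomial_ring_choose k
  have h : zetaPolynomial (IntervalL k r) = q *
      (Polynomial.C (2 * r * k / (k + 1) : ℚ) * (Polynomial.X - 1) *
        zetaPolynomial (PosetL (r - 1)) + zetaPolynomial (PosetL r)) := by
    refine polynomial_eq_of_eval_succ fun p hp => ?_
    have e : ((p : ℚ) + 1) * k = (((p + 1) * k : ℕ) : ℚ) := by push_cast; ring
    rw [eval_zetaPolynomial_intervalL k r hp, hookNum]
    rw [Polynomial.eval_mul, hq, e, Ring.choose_natCast, Polynomial.eval_add, Polynomial.eval_mul,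
      Polynomial.eval_mul, eval_zetaPolynomial_posetL _ hp, eval_zetaPolynomial_posetL _ hp]
    simp
  rw [h]
  simp [hq]

theorem proposition7p1 (k r : ℕ) :
    ((Nat.card (IntervalL k r) : ℚ) =
      ((2 * k).choose k : ℚ) *
        (2 * r * k / (k + 1) * (Nat.card (PosetL (r - 1)) : ℚ) + (Nat.card (PosetL r) : ℚ))) ∧
    (∀ m : ℚ, (zetaPolynomial (IntervalL k r)).eval m =
      Ring.choose (m * k) k *
        (2 * r * k / (k + 1) * (m - 1) * (zetaPolynomial (PosetL (r - 1))).eval m +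
          (zetaPolynomial (PosetL r)).eval m)) ∧
    ((mobiusNumber (IntervalL k r) : ℚ) =
      (-1) ^ (k + r) * ((2 * k - 1).choose k : ℚ) *
        (4 * r * k / (k + 1) * |(mobiusNumber (PosetL (r - 1)) : ℚ)| +
          |(mobiusNumber (PosetL r) : ℚ)|)) := by
  refine ⟨?_, eval_zetaPolynomial_intervalL_eq k r, ?_⟩
  · rw [card_intervalL, card_intervalL, card_intervalL, hookNum_zero_left, hookNum_zero_left,
      hookNum]
    norm_num
  · rw [mobiusNumber_eq_eval, eval_zetaPolynomial_intervalL_eq, ring_choose_neg_self,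
      eval_neg_one_eq_abs, eval_neg_one_eq_abs]
    cases r with
    | zero => simp
    | succ r =>
      -- At `m = -1` the factor `m - 1 = -2` doubles the coefficient to 4, and its sign compensates
      -- the one between indices `r` and `r + 1`.
      rw [add_tsub_cancel_right]
      push_cast
      ring
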